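/- **Setting.** Let $(\Omega,\mathcal F,\mathbb P)$ be a probability space and $S=(S_t)_{t\ge0}$ an integrable, càdlàg, non-decreasing pure-jump process with $S_0=0$ (i.e. $S_t=\sum_{s\le t}\Delta S_s$, $\Delta S_s=S_s-S_{s-}$), with independent increments and without fixed times of discontinuity ($\mathbb P(\Delta S_t\ne 0)=0$ for every $t$). Put $M_t=\mathbb E[S_t]-S_t$, let $\mathcal F^M$ be the natural filtration of $M$, and let the surplus be $U_t=u_0+g(t)+M_t$, where $u_0\ge 0$ and $g:[0,\infty)\to\mathbb R$ is deterministic with $g(0)=0$. (Path properties are understood almost surely.) Fix $T>0$. An *admissible reinsurance strategy* consists of $u_0^R\ge0$ and a càdlàg, $\mathcal F^M$-adapted, non-decreasing pure-jump process $S^R$ with $S^R_0=0$ such that almost surely $0\le\Delta S^R_t\le\Delta S_t$ for all $t\in[0,T]$. With $A^R$ the compensator of $S^R$ with respect to $\mathcal F^M$ (the predictable, càdlàg, non-decreasing process with $A^R_0=0$ such that $S^R-A^R$ is a martingale), set $M^R=A^R-S^R$ and $$U^R_t=u^R_0+g^R(t)+M^R_t,\qquad g^R(t)=g(t)-h(t),\qquad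 t\in[0,T],$$ where $h$ is a given deterministic surcharge on $[0,T]$, which may depend on the joint law of $(M_t,M^R_t)_{t\in[0,T]}$. For a probability measure $\nu$ on $\mathbb R$ with finite second moment, consider $$\inf\Big\{\mathbb E\Big[\sum_{t\in[0,T]}|\Delta S^R_t-\Delta S_t|^2\Big]\;:\;\text{admissible strategies with } U^R_T\sim\nu\Big\}\in[0,\infty].\tag{P}$$ **Theorem.** Assume there is a non-decreasing $1$-Lipschitz map $F:\mathbb R\to\mathbb R$ with $F(M_T)\sim\nu$. Let $\hat F=F-\operatorname{mean}(\nu)$ and $$\hat M^R_t=\mathbb E[\hat F(M_T)\mid M_t],\qquad \hat u^R_0=\operatorname{mean}(\nu)-g^R(T),\qquad \hat U^R_t=\hat u^R_0+g^R(t)+\hat M^R_t,\qquad t\in[0,T],$$ where $g^R=g-h$ is the drift belonging to the joint law of $(M,\hat M^R)$ on $[0,T]$, and assume $\hat u^R_0\ge0$. Then there is an admissible strategy with initial capital $\hat u^R_0$ and with $M^R_t=\hat M^R_t$ and $U^R_t=\hat U^R_t$ a.s. for every $t\in[0,T]$; every such admissible strategy is an optimizer of (P); and, if the value of (P) is finite,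 every optimizer of (P) is of this form. -/

import Mathlib

open MeasureTheory ProbabilityTheory Filter Topology
open scoped NNReal ENNReal

noncomputable section

namespace Reinsurance

variable {Ω : Type*} [MeasurableSpace Ω]

/-- A path is càdlàg: right-continuous with (finite) left limits. -/
def IsCadlag (f : ℝ≥0 → ℝ) : Prop :=
  ∀ t, ContinuousWithinAt f (Set.Ici t) t ∧ ∃ l, Tendsto f (𝓝[<] t) (𝓝 l)

/-- The jump `ΔX_t = X_t - X_{t-}`; at time `0` it is `0`. -/
def jump (X : ℝ≥0 → Ω → ℝ) (t : ℝ≥0) (ω : Ω) : ℝ :=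
  X t ω - Function.leftLim (fun s => X s ω) t

/-- Almost every path of `X` starts at `0`, is càdlàg and non-decreasing, and is the sum of its
jumps: `X_t = ∑_{s ≤ t} ΔX_s` for all `t`. -/
structure IsIncreasingPureJump (μ : Measure Ω) (X : ℝ≥0 → Ω → ℝ) : Prop where
  zero : ∀ᵐ ω ∂μ, X 0 ω = 0
  cadlag : ∀ᵐ ω ∂μ, IsCadlag (fun t => X t ω)
  mono : ∀ᵐ ω ∂μ, Monotone (fun t => X t ω)
  sum_jumps : ∀ᵐ ω ∂μ, ∀ t : ℝ≥0, HasSum (fun s : Set.Iic t => jump X s ω) (X t ω)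

/-- `A` is the compensator of the increasing process `X` with respect to the filtration `ℱ`: it is
predictable, starts at `0`, has càdlàg non-decreasing paths, and `X - A` is a martingale. -/
structure IsCompensator (μ : Measure Ω) (ℱ : Filtration ℝ≥0 ‹MeasurableSpace Ω›)
    (X A : ℝ≥0 → Ω → ℝ) : Prop where
  predictable : IsStronglyPredictable ℱ A
  zero : ∀ᵐ ω ∂μ, A 0 ω = 0
  cadlag : ∀ᵐ ω ∂μ, IsCadlag (fun t => A t ω)
  mono : ∀ᵐ ω ∂μ, Monotone (fun t => A t ω)
  martingale : Martingale (fun t ω => X t ω - A t ω) ℱ μ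

/-- The insurer's model: initial capital `u₀`, deterministic gain function `g`, and cumulative
claims `S`, an integrable non-decreasing pure-jump process with independent increments and without
fixed times of discontinuity. -/
structure SurplusModel (μ : Measure Ω) where
  u₀ : ℝ
  u₀_nonneg : 0 ≤ u₀
  g : ℝ≥0 → ℝ
  g_zero : g 0 = 0
  S : ℝ≥0 → Ω → ℝ
  measurable_S : ∀ t, Measurable (S t)
  integrable_S : ∀ t, Integrable (S t) μ
  pureJump : IsIncreasingPureJump μ S
  indepIncrements : HasIndepIncrements S μ
  no_fixed_jump : ∀ t, ∀ᵐ ω ∂μ, jump S t ω = 0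

/-- A reinsurance strategy: initial capital after reinsurance, retained claims `S^R`, and the
process `A^R` (required below to be the compensator of `S^R`). -/
structure Strategy (Ω : Type*) where
  u₀ : ℝ
  S : ℝ≥0 → Ω → ℝ
  A : ℝ≥0 → Ω → ℝ

/-- `M^R = A^R - S^R`. -/
def Strategy.M (R : Strategy Ω) (t : ℝ≥0) (ω : Ω) : ℝ := R.A t ω - R.S t ω

namespace SurplusModel

variable {μ : Measure Ω} (X : SurplusModel μ)

/-- `M_t = E[S_t] - S_t`. -/
def M (t : ℝ≥0) (ω : Ω) : ℝ := (∫ ω', X.S t ω' ∂μ) - X.S t ω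

/-- The surplus `U_t = u₀ + g(t) + M_t`. -/
def surplus (t : ℝ≥0) (ω : Ω) : ℝ := X.u₀ + X.g t + X.M t ω

theorem stronglyMeasurable_M (t : ℝ≥0) : StronglyMeasurable (X.M t) :=
  (measurable_const.sub (X.measurable_S t)).stronglyMeasurable

/-- The natural filtration `ℱ^M` of `M`. -/
def filtration : Filtration ℝ≥0 ‹MeasurableSpace Ω› :=
  Filtration.natural X.M X.stronglyMeasurable_M

/-- Admissible reinsurance strategies up to the horizon `T`. -/
structure IsAdmissible (T : ℝ≥0) (R : Strategy Ω) : Prop where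
  u₀_nonneg : 0 ≤ R.u₀
  adapted : StronglyAdapted X.filtration R.S
  pureJump : IsIncreasingPureJump μ R.S
  compensator : IsCompensator μ X.filtration R.S R.A
  jump_le : ∀ᵐ ω ∂μ, ∀ t ≤ T, 0 ≤ jump R.S t ω ∧ jump R.S t ω ≤ jump X.S t ω

/-- The joint law on `[0,T]` of the martingale part `M` before reinsurance and a martingale part
`N` after reinsurance. -/
def jointLaw (T : ℝ≥0) (N : ℝ≥0 → Ω → ℝ) : Measure (Set.Icc 0 T → ℝ × ℝ) :=
  μ.map (fun ω t => (X.M t ω, N t ω))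

/-- The drift `g^R = g - h` after reinsurance. The deterministic surcharge `h` may depend on the
law of the surplus before and after reinsurance; only its values at times `t ≤ T` are used. -/
def drift (T : ℝ≥0) (h : Measure (Set.Icc 0 T → ℝ × ℝ) → ℝ≥0 → ℝ) (N : ℝ≥0 → Ω → ℝ)
    (t : ℝ≥0) : ℝ :=
  X.g t - h (X.jointLaw T N) t

/-- The surplus after reinsurance `U^R_t = u₀^R + g^R(t) + M^R_t`, `t ≤ T`. -/
def reinsured (T : ℝ≥0) (h : Measure (Set.Icc 0 T → ℝ × ℝ) → ℝ≥0 → ℝ) (R : Strategy Ω)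
    (t : ℝ≥0) (ω : Ω) : ℝ :=
  R.u₀ + X.drift T h R.M t + R.M t ω

/-- The cost `E[∑_{t ∈ [0,T]} |ΔS^R_t - ΔS_t|²]`, with values in `[0,∞]`. -/
def cost (T : ℝ≥0) (R : Strategy Ω) : ℝ≥0∞ :=
  ∫⁻ ω, ∑' t : Set.Icc 0 T, ENNReal.ofReal ((jump R.S t ω - jump X.S t ω) ^ 2) ∂μ

/-- Admissible strategies with terminal surplus of law `ν`. -/
def IsFeasible (T : ℝ≥0) (h : Measure (Set.Icc 0 T → ℝ × ℝ) → ℝ≥0 → ℝ) (ν : Measure ℝ)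
    (R : Strategy Ω) : Prop :=
  X.IsAdmissible T R ∧ HasLaw (X.reinsured T h R T) ν μ

/-- `R` attains the infimum of the cost over all admissible strategies with terminal law `ν`. -/
def IsOptimal (T : ℝ≥0) (h : Measure (Set.Icc 0 T → ℝ × ℝ) → ℝ≥0 → ℝ) (ν : Measure ℝ)
    (R : Strategy Ω) : Prop :=
  X.IsFeasible T h ν R ∧ ∀ R', X.IsFeasible T h ν R' → X.cost T R ≤ X.cost T R'

/-- `M̂^R_t = E[F̂(M_T) | M_t]` with `F̂ = F - mean(ν)`. -/
def bassM (T : ℝ≥0) (ν : Measure ℝ) (F : ℝ → ℝ) (t : ℝ≥0) : Ω → ℝ :=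
  μ[fun ω => F (X.M T ω) - ∫ x, x ∂ν | MeasurableSpace.comap (X.M t) inferInstance]

/-- `û₀^R = mean(ν) - g^R(T)`, where `g^R` is the drift belonging to `M̂^R`. -/
def bassCapital (T : ℝ≥0) (h : Measure (Set.Icc 0 T → ℝ × ℝ) → ℝ≥0 → ℝ) (ν : Measure ℝ)
    (F : ℝ → ℝ) : ℝ :=
  (∫ x, x ∂ν) - X.drift T h (X.bassM T ν F) T

/-- The strategy `R` has initial capital `û₀^R`, martingale part `M̂^R` and surplus
`Û^R_t = û₀^R + g^R(t) + M̂^R_t` on `[0,T]`. -/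
def IsBass (T : ℝ≥0) (h : Measure (Set.Icc 0 T → ℝ × ℝ) → ℝ≥0 → ℝ) (ν : Measure ℝ)
    (F : ℝ → ℝ) (R : Strategy Ω) : Prop :=
  R.u₀ = X.bassCapital T h ν F ∧
  (∀ t ≤ T, R.M t =ᵐ[μ] X.bassM T ν F t) ∧
  (∀ t ≤ T, X.reinsured T h R t =ᵐ[μ] fun ω =>
    X.bassCapital T h ν F + X.drift T h (X.bassM T ν F) t + X.bassM T ν F t ω)

end SurplusModel

end Reinsurance

end

/-! The dynamic problem collapses to static optimal transport on the line. For every admissible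
strategy the cost equals `E[(M^R_T - M_T)²]` in `[0,∞]` (`IsAdmissible.cost_eq`). Since `S` has a
continuous deterministic compensator and `S^R` has smaller jumps, the compensator `A^R` does not
jump on `[0,T]` (`ae_pathJump_compensator_eq_zero`). Hence the jumps of the finite-variation
martingale `N = M^R - M` are `ΔS - ΔS^R`, and its second moment is its expected sum of squared
jumps. The two inequalities are `lintegral_sq_sub_le` (integration by parts against predictable
integrands) and `lintegral_tsum_sq_jump_le` (orthogonal increments and Fatou); neither presupposes
square integrability.

As `E[M^R_T] = 0`, the constraint on the law of `U^R_T` fixes `u^R_0 + g^R(T) = mean(ν)` and says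
that `M^R_T` has the law of `F̂(M_T)`. Because `F̂` is non-decreasing, `F̂(M_T)` is the unique
variable with this law closest to `M_T` in `L²` (`integral_sq_map_sub_le`,
`ae_eq_of_integral_sq_sub_le`, by convex duality). The martingale property then determines `M^R_t`
from `M^R_T`, and independent increments turn conditioning on the past into conditioning on `M_t`.

Existence uses the value function `v(t,s) = E[F̂(M_T) | S_t = s]`. The process `v(t,S_t)` is a limit
of time increments minus a limit of space decrements along grids. The space part is the pure-jump
process with jumps `v(r,S_{r-}) - v(r,S_r)`, which lie in `[0, ΔS_r]` exactly because `F` is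
non-decreasing and `1`-Lipschitz; this is `S^R`. The time part is predictable, and it is
non-decreasing since `v` is non-decreasing in time; this is `A^R`. -/

namespace Reinsurance

/-! ### Uniform grids on the half-line -/

/-- The point `k / (n + 1)`. -/
noncomputable def grid (n k : ℕ) : ℝ≥0 := k / (n + 1)

/-- The index `k` such that `r` lies in `(k / (n + 1), (k + 1) / (n + 1)]`. -/
noncomputable def gridIdx (n : ℕ) (r : ℝ≥0) : ℕ := ⌈r * (n + 1)⌉₊ - 1

lemma grid_zero (n : ℕ) : grid n 0 = 0 := by simp [grid]

lemma grid_mono (n : ℕ) : Monotone (grid n) := fun a b h => by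
  unfold grid; gcongr

lemma grid_gridIdx_lt (n : ℕ) {r : ℝ≥0} (hr : 0 < r) : grid n (gridIdx n r) < r := by
  have hpos : 0 < ⌈r * (n + 1)⌉₊ := Nat.ceil_pos.2 (by positivity)
  unfold grid
  rw [div_lt_iff₀ (by positivity)]
  exact Nat.lt_ceil.1 (by unfold gridIdx; omega)

lemma le_grid_gridIdx_succ (n : ℕ) (r : ℝ≥0) : r ≤ grid n (gridIdx n r + 1) := by
  unfold grid
  rw [le_div_iff₀ (by positivity)]
  refine (Nat.le_ceil _).trans ?_
  exact_mod_cast (by unfold gridIdx; omega : ⌈r * (n + 1)⌉₊ ≤ gridIdx n r + 1)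

lemma gridIdx_eq_of_mem (n : ℕ) {k : ℕ} {r : ℝ≥0}
    (h : r ∈ Set.Ioc (grid n k) (grid n (k + 1))) : gridIdx n r = k := by
  obtain ⟨h1, h2⟩ := h
  unfold grid at h1 h2
  rw [div_lt_iff₀ (by positivity)] at h1
  rw [le_div_iff₀ (by positivity)] at h2
  have h3 := Nat.lt_ceil.2 h1
  have h4 := Nat.ceil_le.2 h2
  unfold gridIdx
  omega

lemma mem_Ioc_grid_iff (n : ℕ) {k : ℕ} {r : ℝ≥0} (hr : 0 < r) :
    r ∈ Set.Ioc (grid n k) (grid n (k + 1)) ↔ gridIdx n r = k :=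
  ⟨gridIdx_eq_of_mem n, by
    rintro rfl; exact ⟨grid_gridIdx_lt n hr, le_grid_gridIdx_succ n r⟩⟩

/-- The point `0` lies in no half-open cell; truncated subtraction assigns it index `0`, so that
`gridPast` at time `0` is the initial value. -/
lemma grid_gridIdx_zero (n : ℕ) : grid n (gridIdx n 0) = 0 := by simp [grid, gridIdx]

lemma grid_succ (n k : ℕ) : grid n (k + 1) = grid n k + 1 / (n + 1) := by
  simp [grid, add_div]

lemma tendsto_one_div_nnreal : Tendsto (fun n : ℕ => (1 / (n + 1) : ℝ≥0)) atTop (𝓝 0) :=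
  tendsto_one_div_add_atTop_nhds_zero_nat

lemma tendsto_grid_gridIdx {r : ℝ≥0} (hr : 0 < r) :
    Tendsto (fun n => grid n (gridIdx n r)) atTop (𝓝[<] r) := by
  refine tendsto_nhdsWithin_iff.2 ⟨?_, .of_forall fun n => grid_gridIdx_lt n hr⟩
  have h : Tendsto (fun n : ℕ => r - (1 / (n + 1) : ℝ≥0)) atTop (𝓝 r) := by
    simpa using (tendsto_const_nhds (x := r)).sub tendsto_one_div_nnreal
  refine tendsto_of_tendsto_of_tendsto_of_le_of_le h tendsto_const_nhds (fun n => ?_)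
    (fun n => (grid_gridIdx_lt n hr).le)
  have := le_grid_gridIdx_succ n r
  rw [grid_succ] at this
  exact tsub_le_iff_right.2 this

lemma tendsto_grid_gridIdx_succ {r : ℝ≥0} (hr : 0 < r) :
    Tendsto (fun n => grid n (gridIdx n r + 1)) atTop (𝓝[≥] r) := by
  refine tendsto_nhdsWithin_iff.2 ⟨?_, .of_forall fun n => le_grid_gridIdx_succ n r⟩
  simp_rw [grid_succ]
  simpa using ((tendsto_grid_gridIdx hr).mono_right nhdsWithin_le_nhds).add tendsto_one_div_nnreal

/-- The number of grid cells needed to cover `[0, T]`. -/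
noncomputable def gridCard (T : ℝ≥0) (n : ℕ) : ℕ := ⌈T⌉₊ * (n + 1)

lemma le_grid_gridCard (T : ℝ≥0) (n : ℕ) : T ≤ grid n (gridCard T n) := by
  unfold grid gridCard
  rw [le_div_iff₀ (by positivity)]
  push_cast
  gcongr
  exact Nat.le_ceil T

lemma gridIdx_lt_gridCard {T r : ℝ≥0} (n : ℕ) (hr : 0 < r) (hT : r ≤ T) :
    gridIdx n r < gridCard T n := by
  have h := (grid_gridIdx_lt n hr).trans_le (hT.trans (le_grid_gridCard T n))
  by_contra! hc
  exact absurd (grid_mono n hc) (not_le.2 h)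

lemma nhdsLT_neBot_of_pos {r : ℝ≥0} (hr : 0 < r) : (𝓝[<] r).NeBot :=
  (tendsto_grid_gridIdx hr).neBot

/-! ### Jumps of real paths -/

/-- The jump of a path. -/
noncomputable def pathJump (f : ℝ≥0 → ℝ) (t : ℝ≥0) : ℝ := f t - Function.leftLim f t

lemma IsCadlag.tendsto_leftLim {f : ℝ≥0 → ℝ} (hf : IsCadlag f) (t : ℝ≥0) :
    Tendsto f (𝓝[<] t) (𝓝 (Function.leftLim f t)) :=
  tendsto_leftLim_of_tendsto (hf t).2

lemma leftLim_eq_of_tendsto_pos {f : ℝ≥0 → ℝ} {t : ℝ≥0} {l : ℝ} (ht : 0 < t)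
    (h : Tendsto f (𝓝[<] t) (𝓝 l)) : Function.leftLim f t = l :=
  have := nhdsLT_neBot_of_pos ht
  leftLim_eq_of_tendsto h

lemma pathJump_zero (f : ℝ≥0 → ℝ) : pathJump f 0 = 0 := by
  have : IsBot (0 : ℝ≥0) := fun x => zero_le
  rw [pathJump, leftLim_eq_of_isBot this, sub_self]

lemma pathJump_nonneg {f : ℝ≥0 → ℝ} (hf : Monotone f) (t : ℝ≥0) : 0 ≤ pathJump f t :=
  sub_nonneg.2 (hf.leftLim_le le_rfl)

lemma leftLim_comb {f g : ℝ≥0 → ℝ} (hf : IsCadlag f) (hg : IsCadlag g) {t : ℝ≥0} (ht : 0 < t)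
    (a b : ℝ) : Function.leftLim (fun s => a * f s + b * g s) t =
      a * Function.leftLim f t + b * Function.leftLim g t :=
  leftLim_eq_of_tendsto_pos ht
    (((hf.tendsto_leftLim t).const_mul a).add ((hg.tendsto_leftLim t).const_mul b))

lemma pathJump_comb {f g : ℝ≥0 → ℝ} (hf : IsCadlag f) (hg : IsCadlag g) (t : ℝ≥0) (a b : ℝ) :
    pathJump (fun s => a * f s + b * g s) t = a * pathJump f t + b * pathJump g t := by
  rcases eq_zero_or_pos t with rfl | ht
  · simp [pathJump_zero]
  · simp only [pathJump, leftLim_comb hf hg ht]; ring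

lemma pathJump_add {f g : ℝ≥0 → ℝ} (hf : IsCadlag f) (hg : IsCadlag g) (t : ℝ≥0) :
    pathJump (fun s => f s + g s) t = pathJump f t + pathJump g t := by
  simpa using pathJump_comb hf hg t 1 1

lemma pathJump_sub {f g : ℝ≥0 → ℝ} (hf : IsCadlag f) (hg : IsCadlag g) (t : ℝ≥0) :
    pathJump (fun s => f s - g s) t = pathJump f t - pathJump g t := by
  simpa [sub_eq_add_neg] using pathJump_comb hf hg t 1 (-1)

lemma IsCadlag.add {f g : ℝ≥0 → ℝ} (hf : IsCadlag f) (hg : IsCadlag g) :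
    IsCadlag (fun s => f s + g s) := fun t =>
  ⟨(hf t).1.add (hg t).1, _, (hf.tendsto_leftLim t).add (hg.tendsto_leftLim t)⟩

lemma IsCadlag.sub {f g : ℝ≥0 → ℝ} (hf : IsCadlag f) (hg : IsCadlag g) :
    IsCadlag (fun s => f s - g s) := fun t =>
  ⟨(hf t).1.sub (hg t).1, _, (hf.tendsto_leftLim t).sub (hg.tendsto_leftLim t)⟩

lemma isCadlag_of_continuous {f : ℝ≥0 → ℝ} (hf : Continuous f) : IsCadlag f := fun t =>
  ⟨hf.continuousWithinAt, f t, hf.continuousWithinAt⟩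

lemma pathJump_of_continuous {f : ℝ≥0 → ℝ} (hf : Continuous f) (t : ℝ≥0) : pathJump f t = 0 := by
  rcases eq_zero_or_pos t with rfl | ht
  · exact pathJump_zero f
  · rw [pathJump, leftLim_eq_of_tendsto_pos ht hf.continuousWithinAt, sub_self]

lemma isCadlag_of_monotone {f : ℝ≥0 → ℝ} (hf : Monotone f)
    (hc : ∀ t, ContinuousWithinAt f (Set.Ici t) t) : IsCadlag f := fun t =>
  ⟨hc t, _, hf.tendsto_leftLim t⟩

/-! ### Pure-jump paths -/

/-- A path that starts at `0`, is càdlàg and non-decreasing, and is the sum of its jumps. -/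
structure IsPureJumpPath (f : ℝ≥0 → ℝ) : Prop where
  zero : f 0 = 0
  cadlag : IsCadlag f
  mono : Monotone f
  sum_jumps : ∀ t : ℝ≥0, HasSum (fun s : Set.Iic t => pathJump f s) (f t)

lemma IsIncreasingPureJump.ae_isPureJumpPath {Ω : Type*} [MeasurableSpace Ω] {μ : Measure Ω}
    {X : ℝ≥0 → Ω → ℝ} (hX : IsIncreasingPureJump μ X) :
    ∀ᵐ ω ∂μ, IsPureJumpPath (fun t => X t ω) := by
  filter_upwards [hX.zero, hX.cadlag, hX.mono, hX.sum_jumps] with ω h1 h2 h3 h4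
  exact ⟨h1, h2, h3, h4⟩

namespace IsPureJumpPath

variable {s : ℝ≥0 → ℝ}

lemma hasSum_Iic (hs : IsPureJumpPath s) (t : ℝ≥0) :
    HasSum ((Set.Iic t).indicator (pathJump s)) (s t) :=
  hasSum_subtype_iff_indicator.1 (hs.sum_jumps t)

lemma hasSum_Ioc (hs : IsPureJumpPath s) {a b : ℝ≥0} (hab : a ≤ b) :
    HasSum ((Set.Ioc a b).indicator (pathJump s)) (s b - s a) := by
  convert! (hs.hasSum_Iic b).sub (hs.hasSum_Iic a) using 1
  ext r
  by_cases h1 : r ≤ a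
  · simp [Set.indicator, h1, h1.trans hab, not_lt.2 h1]
  · by_cases h2 : r ≤ b <;> simp [Set.indicator, h1, h2, not_le.1 h1]

end IsPureJumpPath

/-! ### Sums of dominated jumps -/

section DominatedJumps

variable {s c : ℝ≥0 → ℝ}

/-- The pure-jump path with jumps `c`. -/
noncomputable def jumpSum (c : ℝ≥0 → ℝ) (t : ℝ≥0) : ℝ := ∑' r, (Set.Iic t).indicator c r

lemma summable_indicator_of_le (hs : IsPureJumpPath s) (h0 : ∀ r, 0 ≤ c r)
    (hc : ∀ r, c r ≤ pathJump s r) (t : ℝ≥0) : Summable ((Set.Iic t).indicator c) :=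
  (hs.hasSum_Iic t).summable.of_nonneg_of_le
    (fun r => Set.indicator_nonneg (fun r _ => h0 r) r)
    (fun _ => Set.indicator_le_indicator (hc _))

lemma jumpSum_sub (hs : IsPureJumpPath s) (h0 : ∀ r, 0 ≤ c r)
    (hc : ∀ r, c r ≤ pathJump s r) {a b : ℝ≥0} (hab : a ≤ b) :
    HasSum ((Set.Ioc a b).indicator c) (jumpSum c b - jumpSum c a) := by
  convert! (summable_indicator_of_le hs h0 hc b).hasSum.sub
    (summable_indicator_of_le hs h0 hc a).hasSum using 1
  ext r
  by_cases h1 : r ≤ a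
  · simp [Set.indicator, h1, h1.trans hab, not_lt.2 h1]
  · by_cases h2 : r ≤ b <;> simp [Set.indicator, h1, h2, not_le.1 h1]

lemma jumpSum_sub_nonneg (hs : IsPureJumpPath s) (h0 : ∀ r, 0 ≤ c r)
    (hc : ∀ r, c r ≤ pathJump s r) {a b : ℝ≥0} (hab : a ≤ b) :
    0 ≤ jumpSum c b - jumpSum c a :=
  (jumpSum_sub hs h0 hc hab).nonneg fun r => Set.indicator_nonneg (fun r _ => h0 r) r

lemma jumpSum_sub_le (hs : IsPureJumpPath s) (h0 : ∀ r, 0 ≤ c r)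
    (hc : ∀ r, c r ≤ pathJump s r) {a b : ℝ≥0} (hab : a ≤ b) :
    jumpSum c b - jumpSum c a ≤ s b - s a :=
  hasSum_le (fun _ => Set.indicator_le_indicator (hc _)) (jumpSum_sub hs h0 hc hab)
    (hs.hasSum_Ioc hab)

/-- The increment of `jumpSum c` over `(a, b]` is between `c b` and `c b + s (b-) - s a`. -/
lemma jumpSum_sub_mem (hs : IsPureJumpPath s) (h0 : ∀ r, 0 ≤ c r)
    (hc : ∀ r, c r ≤ pathJump s r) {a b : ℝ≥0} (hab : a < b) :
    c b ≤ jumpSum c b - jumpSum c a ∧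
      jumpSum c b - jumpSum c a ≤ c b + (Function.leftLim s b - s a) := by
  have h1 := jumpSum_sub hs h0 hc hab.le
  constructor
  · have := le_hasSum h1 b (fun r _ => Set.indicator_nonneg (fun r _ => h0 r) r)
    simpa [Set.indicator, hab] using this
  -- Removing the jump at `b` leaves the jumps in `(a, b)`, which are dominated by those of `s`, of
  -- total size `s (b-) - s a`.
  · have h2 := (hs.hasSum_Ioc hab.le).sub (hasSum_ite_eq b (pathJump s b))
    have h3 := h1.sub (hasSum_ite_eq b (c b))
    have := hasSum_le (fun r => ?_) h3 h2
    · unfold pathJump at this; linarith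
    · by_cases hr : r = b
      · subst hr; simp [Set.indicator, hab]
      · simp only [hr, if_false, sub_zero]
        exact Set.indicator_le_indicator (hc _)

lemma tendsto_jumpSum_left (hs : IsPureJumpPath s) (h0 : ∀ r, 0 ≤ c r)
    (hc : ∀ r, c r ≤ pathJump s r) (t : ℝ≥0) :
    Tendsto (jumpSum c) (𝓝[<] t) (𝓝 (jumpSum c t - c t)) := by
  have hl := hs.mono.tendsto_leftLim t
  have h1 : Tendsto (fun a => jumpSum c t - c t - (Function.leftLim s t - s a)) (𝓝[<] t)
      (𝓝 (jumpSum c t - c t)) := by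
    simpa using (tendsto_const_nhds (x := jumpSum c t - c t)).sub
      ((tendsto_const_nhds (x := Function.leftLim s t)).sub hl)
  refine tendsto_of_tendsto_of_tendsto_of_le_of_le' h1 tendsto_const_nhds ?_ ?_ <;>
  · filter_upwards [self_mem_nhdsWithin] with a ha
    have := jumpSum_sub_mem hs h0 hc (Set.mem_Iio.1 ha)
    linarith [this.1, this.2]

/-- Increments of `jumpSum c` are squeezed between `0` and those of `s`, so right-continuity passes
from `s`; the left limits come from `tendsto_jumpSum_left`. This builds the retained claims from
their prescribed jumps. -/
lemma isPureJumpPath_jumpSum (hs : IsPureJumpPath s) (h0 : ∀ r, 0 ≤ c r)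
    (hc : ∀ r, c r ≤ pathJump s r) :
    IsPureJumpPath (jumpSum c) ∧ pathJump (jumpSum c) = c := by
  have hmono : Monotone (jumpSum c) := fun a b hab =>
    sub_nonneg.1 (jumpSum_sub_nonneg hs h0 hc hab)
  have hc0 : c 0 = 0 := le_antisymm ((hc 0).trans (pathJump_zero s).le) (h0 0)
  have hj : pathJump (jumpSum c) = c := by
    ext t
    rcases eq_zero_or_pos t with rfl | ht
    · rw [pathJump_zero, hc0]
    · rw [pathJump, leftLim_eq_of_tendsto_pos ht (tendsto_jumpSum_left hs h0 hc t)]; ring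
  refine ⟨⟨?_, isCadlag_of_monotone hmono fun t => ?_, hmono, fun t => ?_⟩, hj⟩
  · rw [jumpSum, tsum_eq_single 0]
    · simp [hc0]
    · intro b hb; simp [Set.indicator, hb]
  · have h1 : Tendsto (fun b => jumpSum c t + (s b - s t)) (𝓝[≥] t) (𝓝 (jumpSum c t)) := by
      simpa using (tendsto_const_nhds (x := jumpSum c t)).add
        ((hs.cadlag t).1.tendsto.sub (tendsto_const_nhds (x := s t)))
    refine tendsto_of_tendsto_of_tendsto_of_le_of_le' tendsto_const_nhds h1 ?_ ?_ <;>
    · filter_upwards [self_mem_nhdsWithin] with b hb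
      have h1 := jumpSum_sub_nonneg hs h0 hc (Set.mem_Ici.1 hb)
      have h2 := jumpSum_sub_le hs h0 hc (Set.mem_Ici.1 hb)
      linarith
  · rw [hj]
    exact hasSum_subtype_iff_indicator.2 (summable_indicator_of_le hs h0 hc t).hasSum

end DominatedJumps

/-! ### Grid sums along a pure-jump path -/

/-- A function of time and space that is continuous in time, and non-increasing and
`1`-Lipschitz in space. -/
structure IsAntitoneLip (φ : ℝ≥0 → ℝ → ℝ) : Prop where
  cont : Continuous (Function.uncurry φ)
  anti : ∀ t, Antitone (φ t)
  lip : ∀ t x y, x ≤ y → φ t x - φ t y ≤ y - x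

/-- Sum over the grid cells of `[0, t]` of the decrements of `φ` in space along the path `s`. -/
noncomputable def spaceSum (φ : ℝ≥0 → ℝ → ℝ) (s : ℝ≥0 → ℝ) (K n : ℕ) (t : ℝ≥0) : ℝ :=
  ∑ k ∈ Finset.range K, (φ (min t (grid n (k + 1))) (s (min t (grid n k))) -
    φ (min t (grid n (k + 1))) (s (min t (grid n (k + 1)))))

/-- Sum over the grid cells of `[0, t]` of the increments of `φ` in time along the path `s`. -/
noncomputable def timeSum (φ : ℝ≥0 → ℝ → ℝ) (s : ℝ≥0 → ℝ) (K n : ℕ) (t : ℝ≥0) : ℝ :=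
  ∑ k ∈ Finset.range K, (φ (min t (grid n (k + 1))) (s (min t (grid n k))) -
    φ (min t (grid n k)) (s (min t (grid n k))))

/-- On a cell with endpoints `a ≤ b` the increment is split at `φ b (s a)`: time moves while the
path is frozen at the left end, then space moves at the right end. Freezing at the left end is what
later makes the time part predictable. -/
lemma timeSum_sub_spaceSum (φ : ℝ≥0 → ℝ → ℝ) (s : ℝ≥0 → ℝ) {T t : ℝ≥0} (n : ℕ) (ht : t ≤ T) :
    timeSum φ s (gridCard T n) n t - spaceSum φ s (gridCard T n) n t = φ t (s t) - φ 0 (s 0) := by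
  have h := Finset.sum_range_sub (fun k => φ (min t (grid n k)) (s (min t (grid n k))))
    (gridCard T n)
  rw [min_eq_left (ht.trans (le_grid_gridCard T n)), grid_zero, min_eq_right zero_le] at h
  rw [← h, timeSum, spaceSum, ← Finset.sum_sub_distrib]
  exact Finset.sum_congr rfl fun k _ => by ring

/-- The decrement of `φ` caused by the jump of `s` at time `r`. -/
noncomputable def jumpDecr (φ : ℝ≥0 → ℝ → ℝ) (s : ℝ≥0 → ℝ) (r : ℝ≥0) : ℝ :=
  φ r (Function.leftLim s r) - φ r (s r)

lemma jumpDecr_nonneg {φ : ℝ≥0 → ℝ → ℝ} (hφ : IsAntitoneLip φ) {s : ℝ≥0 → ℝ} (hs : Monotone s)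
    (r : ℝ≥0) : 0 ≤ jumpDecr φ s r :=
  sub_nonneg.2 (hφ.anti r (hs.leftLim_le le_rfl))

lemma jumpDecr_le {φ : ℝ≥0 → ℝ → ℝ} (hφ : IsAntitoneLip φ) {s : ℝ≥0 → ℝ} (hs : Monotone s)
    (r : ℝ≥0) : jumpDecr φ s r ≤ pathJump s r :=
  hφ.lip r _ _ (hs.leftLim_le le_rfl)

/-- The difference quotient of `φ` in space over a cell. -/
noncomputable def cellSlope (φ : ℝ≥0 → ℝ → ℝ) (s : ℝ≥0 → ℝ) (a b : ℝ≥0) : ℝ :=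
  (φ b (s a) - φ b (s b)) / (s b - s a)

lemma cellSlope_mem {φ : ℝ≥0 → ℝ → ℝ} (hφ : IsAntitoneLip φ) {s : ℝ≥0 → ℝ} (hs : Monotone s)
    {a b : ℝ≥0} (hab : a ≤ b) : 0 ≤ cellSlope φ s a b ∧ cellSlope φ s a b ≤ 1 :=
  ⟨div_nonneg (sub_nonneg.2 (hφ.anti b (hs hab))) (sub_nonneg.2 (hs hab)),
    div_le_one_of_le₀ (hφ.lip b _ _ (hs hab)) (sub_nonneg.2 (hs hab))⟩

lemma cellSlope_mul {φ : ℝ≥0 → ℝ → ℝ} {s : ℝ≥0 → ℝ} {a b : ℝ≥0} :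
    cellSlope φ s a b * (s b - s a) = φ b (s a) - φ b (s b) := by
  by_cases h : s b - s a = 0
  · rw [h, mul_zero, sub_eq_zero.1 h, sub_self]
  · rw [cellSlope, div_mul_cancel₀ _ h]

/-- A cell decrement is its slope, a number in `[0,1]`, times the sum of the jumps of `s` in the
cell. The grid sum is thus a sum over jump times `r`, dominated by the jumps of `s`, and the slope
of the cell around `r` tends to `jumpDecr φ s r / pathJump s r`. -/
lemma tendsto_spaceSum {φ : ℝ≥0 → ℝ → ℝ} (hφ : IsAntitoneLip φ) {s : ℝ≥0 → ℝ}
    (hs : IsPureJumpPath s) {T t : ℝ≥0} (ht : t ≤ T) :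
    Tendsto (fun n => spaceSum φ s (gridCard T n) n t) atTop (𝓝 (jumpSum (jumpDecr φ s) t)) := by
  set a : ℕ → ℕ → ℝ≥0 := fun n k => min t (grid n k) with ha
  have hab : ∀ n k, a n k ≤ a n (k + 1) := fun n k => min_le_min_left t (grid_mono n k.le_succ)
  set f : ℕ → ℝ≥0 → ℝ := fun n r =>
    (Set.Ioc 0 t).indicator
      (fun r => cellSlope φ s (a n (gridIdx n r)) (a n (gridIdx n r + 1)) * pathJump s r) r with hf
  have hterm : ∀ n, spaceSum φ s (gridCard T n) n t = ∑' r, f n r := by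
    intro n
    have h1 : HasSum (fun r => ∑ k ∈ Finset.range (gridCard T n), cellSlope φ s (a n k) (a n (k + 1)) *
        (Set.Ioc (a n k) (a n (k + 1))).indicator (pathJump s) r)
        (∑ k ∈ Finset.range (gridCard T n),
          cellSlope φ s (a n k) (a n (k + 1)) * (s (a n (k + 1)) - s (a n k))) :=
      hasSum_sum fun k _ => (hs.hasSum_Ioc (hab n k)).mul_left _
    simp_rw [cellSlope_mul] at h1
    rw [spaceSum, ← h1.tsum_eq]
    congr 1
    ext r
    by_cases hr : r ∈ Set.Ioc 0 t
    · rw [hf]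
      simp only
      rw [Set.indicator_of_mem hr, Finset.sum_eq_single (gridIdx n r)]
      · rw [Set.indicator_of_mem]
        refine ⟨(min_le_right _ _).trans_lt (grid_gridIdx_lt n hr.1),
          le_min hr.2 (le_grid_gridIdx_succ n r)⟩
      · intro k _ hk
        rw [Set.indicator_of_notMem, mul_zero]
        rintro ⟨h2, h3⟩
        rw [ha] at h2 h3
        simp only [min_lt_iff, le_min_iff] at h2 h3
        refine hk (gridIdx_eq_of_mem n ⟨?_, h3.2⟩).symm
        rcases h2 with h2 | h2
        · exact absurd h2 (not_lt.2 hr.2)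
        · exact h2
      · intro hk
        exact absurd (Finset.mem_range.2 (gridIdx_lt_gridCard n hr.1 (hr.2.trans ht))) hk
    · rw [hf]
      simp only
      rw [Set.indicator_of_notMem hr]
      refine Finset.sum_eq_zero fun k _ => ?_
      rw [Set.indicator_of_notMem, mul_zero]
      rintro ⟨h2, h3⟩
      exact hr ⟨zero_le.trans_lt h2, h3.trans (min_le_left _ _)⟩
  simp_rw [hterm, jumpSum]
  refine tendsto_tsum_of_dominated_convergence (hs.hasSum_Iic t).summable (fun r => ?_)
    (.of_forall fun n r => ?_)
  · by_cases hr : r ∈ Set.Ioc 0 t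
    · have hr' : r ∈ Set.Iic t := hr.2
      simp only [hf, Set.indicator_of_mem hr, Set.indicator_of_mem hr']
      -- The limit of the slopes is a quotient with denominator `pathJump s r`; without a jump both
      -- terms vanish instead.
      by_cases hj : pathJump s r = 0
      · have hd : jumpDecr φ s r = 0 :=
          le_antisymm ((jumpDecr_le hφ hs.mono r).trans hj.le) (jumpDecr_nonneg hφ hs.mono r)
        simp [hj, hd]
      · have hA : Tendsto (fun n => a n (gridIdx n r)) atTop (𝓝[<] r) := by
          refine (tendsto_grid_gridIdx hr.1).congr fun n => ?_
          exact (min_eq_right ((grid_gridIdx_lt n hr.1).le.trans hr.2)).symm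
        have hB : Tendsto (fun n => a n (gridIdx n r + 1)) atTop (𝓝[≥] r) := by
          refine tendsto_nhdsWithin_iff.2 ⟨?_, .of_forall fun n =>
            le_min hr.2 (le_grid_gridIdx_succ n r)⟩
          have := (tendsto_const_nhds (x := t)).min
            ((tendsto_grid_gridIdx_succ hr.1).mono_right nhdsWithin_le_nhds)
          rwa [min_eq_right hr.2] at this
        have hsA := (hs.cadlag.tendsto_leftLim r).comp hA
        have hsB : Tendsto (fun n => s (a n (gridIdx n r + 1))) atTop (𝓝 (s r)) :=
          (hs.cadlag r).1.tendsto.comp hB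
        have hB' := hB.mono_right nhdsWithin_le_nhds
        have h1 : Tendsto (fun n => φ (a n (gridIdx n r + 1)) (s (a n (gridIdx n r)))) atTop
            (𝓝 (φ r (Function.leftLim s r))) :=
          (hφ.cont.tendsto (r, Function.leftLim s r)).comp (hB'.prodMk_nhds hsA)
        have h2 : Tendsto (fun n => φ (a n (gridIdx n r + 1)) (s (a n (gridIdx n r + 1)))) atTop
            (𝓝 (φ r (s r))) :=
          (hφ.cont.tendsto (r, s r)).comp (hB'.prodMk_nhds hsB)
        have h3 := ((h1.sub h2).div (hsB.sub hsA) hj).mul_const (pathJump s r)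
        rw [show s r - Function.leftLim s r = pathJump s r from rfl,
          div_mul_cancel₀ _ hj] at h3
        exact h3
    · have h0 : (fun n => f n r) = fun _ => (0 : ℝ) := by
        ext n; simp only [hf, Set.indicator_of_notMem hr]
      have hd : (Set.Iic t).indicator (jumpDecr φ s) r = 0 := by
        by_cases h : r ≤ t
        · have : r = 0 := by
            by_contra h'
            exact hr ⟨pos_iff_ne_zero.2 h', h⟩
          subst this
          rw [Set.indicator_of_mem (by simp)]
          exact le_antisymm ((jumpDecr_le hφ hs.mono 0).trans (pathJump_zero s).le)
            (jumpDecr_nonneg hφ hs.mono 0)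
        · rw [Set.indicator_of_notMem (by simpa using h)]
      rw [h0, hd]
      exact tendsto_const_nhds
  · by_cases hr : r ∈ Set.Ioc 0 t
    · have hr' : r ∈ Set.Iic t := hr.2
      simp only [hf, Set.indicator_of_mem hr, Set.indicator_of_mem hr']
      have h1 := cellSlope_mem hφ hs.mono (hab n (gridIdx n r))
      have h2 := pathJump_nonneg hs.mono r
      rw [Real.norm_of_nonneg (mul_nonneg h1.1 h2)]
      exact mul_le_of_le_one_left h2 h1.2
    · simp only [hf, Set.indicator_of_notMem hr, norm_zero]
      exact Set.indicator_nonneg (fun r _ => pathJump_nonneg hs.mono r) r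

/-- As a function of `t`, each summand is zero up to its cell and then an increment of `φ` in time
at a frozen space point. -/
lemma timeSum_mono {φ : ℝ≥0 → ℝ → ℝ} (hφ : ∀ x, Monotone fun t => φ t x) (s : ℝ≥0 → ℝ)
    (K n : ℕ) : Monotone (timeSum φ s K n) := by
  intro t u htu
  refine Finset.sum_le_sum fun k _ => ?_
  rcases le_total t (grid n k) with h | h
  · have h1 : min t (grid n (k + 1)) = t := min_eq_left (h.trans (grid_mono n k.le_succ))
    rw [h1, min_eq_left h, sub_self]
    exact sub_nonneg.2 (hφ _ (min_le_min_left _ (grid_mono n k.le_succ)))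
  · rw [min_eq_right h, min_eq_right (h.trans htu)]
    exact sub_le_sub_right (hφ _ (min_le_min_right _ htu)) _

/-! ### Squared increments along the grid -/

/-- The sum of the squared increments of a path over the grid cells of `[0, T]`. -/
noncomputable def sqSum (f : ℝ≥0 → ℝ) (T : ℝ≥0) (n : ℕ) : ℝ :=
  ∑ k ∈ Finset.range (gridCard T n), (f (min T (grid n (k + 1))) - f (min T (grid n k))) ^ 2

/-- Finitely many jump times lie in distinct cells once the grid is fine, and the increments over
those cells tend to the jumps; the squares over the other cells are dropped. -/
lemma tsum_sq_pathJump_le_liminf {f : ℝ≥0 → ℝ} (hf : IsCadlag f) (T : ℝ≥0) :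
    ∑' t : Set.Icc 0 T, ENNReal.ofReal (pathJump f t ^ 2) ≤
      liminf (fun n => ENNReal.ofReal (sqSum f T n)) atTop := by
  rw [tsum_subtype (Set.Icc 0 T) (fun t => ENNReal.ofReal (pathJump f t ^ 2)),
    ENNReal.tsum_eq_iSup_sum]
  refine iSup_le fun J => ?_
  rw [Finset.sum_indicator_eq_sum_filter]
  set J' := (J.filter (· ∈ Set.Icc 0 T)).filter (0 < ·) with hJ'
  have hsum : ∑ t ∈ J.filter (· ∈ Set.Icc 0 T), ENNReal.ofReal (pathJump f t ^ 2) =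
      ENNReal.ofReal (∑ t ∈ J', pathJump f t ^ 2) := by
    rw [ENNReal.ofReal_sum_of_nonneg fun _ _ => sq_nonneg _, hJ']
    symm
    refine Finset.sum_subset (Finset.filter_subset _ _) fun t _ ht => ?_
    rcases eq_zero_or_pos t with rfl | h
    · simp [pathJump_zero]
    · exact absurd (Finset.mem_filter.2 ⟨‹_›, h⟩) ht
  rw [hsum]
  have hmem : ∀ t ∈ J', 0 < t ∧ t ≤ T := fun t ht => by
    simp only [hJ', Finset.mem_filter, Set.mem_Icc] at ht
    exact ⟨ht.2, ht.1.2.2⟩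
  set g : ℕ → ℝ≥0 → ℝ := fun n t =>
    (f (min T (grid n (gridIdx n t + 1))) - f (min T (grid n (gridIdx n t)))) ^ 2 with hg
  have hlim : Tendsto (fun n => ENNReal.ofReal (∑ t ∈ J', g n t)) atTop
      (𝓝 (ENNReal.ofReal (∑ t ∈ J', pathJump f t ^ 2))) := by
    refine ENNReal.tendsto_ofReal (tendsto_finsetSum _ fun t ht => ?_)
    obtain ⟨h0, hT⟩ := hmem t ht
    have hA : Tendsto (fun n => min T (grid n (gridIdx n t))) atTop (𝓝[<] t) := by
      refine (tendsto_grid_gridIdx h0).congr fun n => ?_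
      exact (min_eq_right ((grid_gridIdx_lt n h0).le.trans hT)).symm
    have hB : Tendsto (fun n => min T (grid n (gridIdx n t + 1))) atTop (𝓝[≥] t) := by
      refine tendsto_nhdsWithin_iff.2 ⟨?_, .of_forall fun n =>
        le_min hT (le_grid_gridIdx_succ n t)⟩
      have := (tendsto_const_nhds (x := T)).min
        ((tendsto_grid_gridIdx_succ h0).mono_right nhdsWithin_le_nhds)
      rwa [min_eq_right hT] at this
    exact (((hf t).1.tendsto.comp hB).sub ((hf.tendsto_leftLim t).comp hA)).pow 2
  have hinj : ∀ᶠ n in atTop, ∀ t ∈ J', ∀ u ∈ J', t ≠ u → gridIdx n t ≠ gridIdx n u := by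
    refine (Finset.eventually_all J').2 fun t ht => (Finset.eventually_all J').2 fun u hu => ?_
    by_cases htu : t = u
    · exact .of_forall fun _ h => absurd htu h
    wlog hlt : t < u generalizing t u
    · filter_upwards [this u hu t ht (Ne.symm htu) (lt_of_le_of_ne (not_lt.1 hlt) (Ne.symm htu))]
        with n hn h1 h2
      exact hn h1.symm h2.symm
    filter_upwards [(tendsto_grid_gridIdx (hmem u hu).1).eventually
      (nhdsWithin_le_nhds (Ioi_mem_nhds hlt))] with n hn _ h
    have h1 := grid_gridIdx_lt n (hmem t ht).1
    rw [h] at h1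
    exact absurd (Set.mem_Ioi.1 hn) (not_lt.2 h1.le)
  rw [← hlim.liminf_eq]
  refine liminf_le_liminf ?_
  filter_upwards [hinj] with n hn
  refine ENNReal.ofReal_le_ofReal ?_
  have himg : ∑ t ∈ J', g n t = ∑ k ∈ J'.image (gridIdx n),
      (f (min T (grid n (k + 1))) - f (min T (grid n k))) ^ 2 := by
    rw [Finset.sum_image]
    intro t ht u hu h
    by_contra hne
    exact hn t ht u hu hne h
  rw [himg]
  refine Finset.sum_le_sum_of_subset_of_nonneg (fun k hk => ?_) fun _ _ _ => sq_nonneg _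
  obtain ⟨t, ht, rfl⟩ := Finset.mem_image.1 hk
  exact Finset.mem_range.2 (gridIdx_lt_gridCard n (hmem t ht).1 (hmem t ht).2)

/-! ### Stieltjes measures of increasing paths -/

/-- Non-decreasing, right-continuous paths. -/
def IsStieltjesPath (f : ℝ≥0 → ℝ) : Prop :=
  Monotone f ∧ ∀ t, ContinuousWithinAt f (Set.Ici t) t

open Classical in
/-- The Stieltjes measure of a non-decreasing, right-continuous path, restricted to `(0, T]`;
it is `0` for other paths. -/
noncomputable def pathMeasure (T : ℝ≥0) (f : ℝ≥0 → ℝ) : Measure ℝ≥0 :=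
  if h : IsStieltjesPath f then
    (StieltjesFunction.mk f h.1 h.2).measure.restrict (Set.Ioc 0 T) else 0

section PathMeasure

variable {T : ℝ≥0} {f : ℝ≥0 → ℝ}

lemma pathMeasure_apply_of_subset (hf : IsStieltjesPath f) {B : Set ℝ≥0} (hB : B ⊆ Set.Ioc 0 T) :
    pathMeasure T f B = (StieltjesFunction.mk f hf.1 hf.2).measure B := by
  rw [pathMeasure, dif_pos hf, Measure.restrict_eq_self _ hB]

lemma pathMeasure_compl (f : ℝ≥0 → ℝ) : pathMeasure T f (Set.Ioc 0 T)ᶜ = 0 := by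
  rw [pathMeasure]
  split_ifs with h
  · rw [Measure.restrict_apply measurableSet_Ioc.compl]; simp
  · simp

lemma pathMeasure_univ (hf : IsStieltjesPath f) :
    pathMeasure T f Set.univ = ENNReal.ofReal (f T - f 0) := by
  rw [pathMeasure, dif_pos hf, Measure.restrict_apply_univ, StieltjesFunction.measure_Ioc]

instance : IsFiniteMeasure (pathMeasure T f) := by
  by_cases hf : IsStieltjesPath f
  · exact ⟨by rw [pathMeasure_univ hf]; exact ENNReal.ofReal_lt_top⟩
  · rw [pathMeasure, dif_neg hf]; infer_instance

lemma pathMeasure_Ioi (hf : IsStieltjesPath f) (i : ℝ≥0) :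
    pathMeasure T f (Set.Ioi i) = ENNReal.ofReal (f T - f (min i T)) := by
  rw [pathMeasure, dif_pos hf, Measure.restrict_apply measurableSet_Ioi]
  have : Set.Ioi i ∩ Set.Ioc 0 T = Set.Ioc (min i T) T := by
    ext x
    simp only [Set.mem_inter_iff, Set.mem_Ioi, Set.mem_Ioc, min_lt_iff]
    constructor
    · rintro ⟨h1, _, h3⟩; exact ⟨Or.inl h1, h3⟩
    · rintro ⟨h1 | h1, h2⟩
      · exact ⟨h1, zero_le.trans_lt h1, h2⟩
      · exact absurd h1 (not_lt.2 h2)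
  rw [this, StieltjesFunction.measure_Ioc]

lemma pathMeasure_singleton (hf : IsStieltjesPath f) (t : ℝ≥0) :
    pathMeasure T f {t} = if t ≤ T then ENNReal.ofReal (pathJump f t) else 0 := by
  split_ifs with h
  · rcases eq_zero_or_pos t with rfl | h0
    · rw [pathJump_zero, ENNReal.ofReal_zero]
      exact measure_mono_null (by simp) (pathMeasure_compl f)
    · rw [pathMeasure_apply_of_subset hf (by simpa using ⟨h0, h⟩),
        StieltjesFunction.measure_singleton]
      rfl
  · exact measure_mono_null (by simpa using fun _ => not_le.1 h) (pathMeasure_compl f)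

lemma pathMeasure_Iio (hf : IsStieltjesPath f) {t : ℝ≥0} (ht : t ≤ T) :
    pathMeasure T f (Set.Iio t) = ENNReal.ofReal (Function.leftLim f t - f 0) := by
  have h1 : pathMeasure T f (Set.Iio t) = pathMeasure T f (Set.Ioo 0 t) := by
    refine le_antisymm ?_ (measure_mono fun x hx => hx.2)
    have : Set.Iio t ⊆ Set.Ioo 0 t ∪ {0} := fun x hx => by
      rcases eq_zero_or_pos x with rfl | h
      · exact Or.inr rfl
      · exact Or.inl ⟨h, hx⟩
    refine (measure_mono this).trans ((measure_union_le _ _).trans ?_)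
    rw [pathMeasure_singleton hf, pathJump_zero]
    simp
  rw [h1, pathMeasure_apply_of_subset hf fun x hx => ⟨hx.1, hx.2.le.trans ht⟩,
    StieltjesFunction.measure_Ioo]

lemma countable_pathJump_ne_zero (hf : IsStieltjesPath f) : {t | pathJump f t ≠ 0}.Countable := by
  refine Set.Countable.mono ?_ (StieltjesFunction.mk f hf.1 hf.2).countable_leftLim_ne
  intro t ht h
  exact ht (sub_eq_zero.2 h.symm)

end PathMeasure

lemma IsCadlag.isStieltjesPath {f : ℝ≥0 → ℝ} (hf : IsCadlag f) (hm : Monotone f) :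
    IsStieltjesPath f := ⟨hm, fun t => (hf t).1⟩

/-! ### The Doléans measure of an increasing process -/

variable {Ω : Type*} [m : MeasurableSpace Ω] {μ : Measure Ω}

/-- The kernel integrated in the Doléans measure. -/
noncomputable def doleansKernel (T : ℝ≥0) (B : ℝ≥0 → Ω → ℝ) (ω : Ω) : Measure (ℝ≥0 × Ω) :=
  (pathMeasure T (fun t => B t ω)).map (fun s => (s, ω))

/-- The Doléans measure `E[∫_{(0,T]} 1_{(s, ω)} dB_s]` of an increasing process. -/
noncomputable def doleans (μ : Measure Ω) (T : ℝ≥0) (B : ℝ≥0 → Ω → ℝ) : Measure (ℝ≥0 × Ω) :=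
  μ.bind (doleansKernel T B)

lemma doleansKernel_apply (T : ℝ≥0) (B : ℝ≥0 → Ω → ℝ) (ω : Ω) {E : Set (ℝ≥0 × Ω)}
    (hE : MeasurableSet E) :
    doleansKernel T B ω E = pathMeasure T (fun t => B t ω) ((fun s => (s, ω)) ⁻¹' E) :=
  Measure.map_apply measurable_prodMk_right hE

/-- The open upper rays together with the whole line. -/
def upperRays : Set (Set ℝ≥0) := insert Set.univ (Set.range Set.Ioi)

lemma isPiSystem_upperRays : IsPiSystem upperRays := by
  rintro _ (rfl | ⟨a, rfl⟩) _ (rfl | ⟨b, rfl⟩) _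
  · exact Or.inl (Set.univ_inter _)
  · exact Or.inr ⟨b, (Set.univ_inter _).symm⟩
  · exact Or.inr ⟨a, (Set.inter_univ _).symm⟩
  · exact Or.inr ⟨max a b, by simp [Set.Ioi_inter_Ioi]⟩

lemma generateFrom_upperRays :
    MeasurableSpace.generateFrom upperRays = (inferInstance : MeasurableSpace ℝ≥0) := by
  rw [upperRays, MeasurableSpace.generateFrom_insert_univ,
    BorelSpace.measurable_eq (α := ℝ≥0), borel_eq_generateFrom_Ioi]

/-- The whole line belongs to `upperRays` because no ray `Set.Ioi a` contains `0`, while rectangles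
generate the product σ-algebra only if their factors countably span. -/
lemma generateFrom_upperRays_prod :
    (Prod.instMeasurableSpace : MeasurableSpace (ℝ≥0 × Ω)) = MeasurableSpace.generateFrom
      (Set.image2 (· ×ˢ ·) upperRays {s | MeasurableSet s}) :=
  (generateFrom_eq_prod generateFrom_upperRays MeasurableSpace.generateFrom_measurableSet
    ⟨fun _ => Set.univ, fun _ => Or.inl rfl, Set.iUnion_const _⟩
    ⟨fun _ => Set.univ, fun _ => MeasurableSet.univ, Set.iUnion_const _⟩).symm

/-- The mass of an upper ray is an explicit increment of the path, hence measurable in `ω`;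
rectangles over such rays form a generating π-system. The kernel is replaced by `0` on a null set of
bad paths. -/
lemma aemeasurable_doleansKernel {T : ℝ≥0} {B : ℝ≥0 → Ω → ℝ} (hB : ∀ t, Measurable (B t))
    (hpath : ∀ᵐ ω ∂μ, IsStieltjesPath (fun t => B t ω)) :
    AEMeasurable (doleansKernel T B) μ := by
  classical
  obtain ⟨G, hGsub, hG, hGnull⟩ := eventually_iff_exists_mem.1 hpath |>.elim
    -- The good paths need not form a measurable set; the complement of a measurable hull of the bad
    -- ones does.
    fun v hv => (⟨(toMeasurable μ vᶜ)ᶜ, fun ω hω => hv.2 ω (by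
      by_contra h; exact hω (subset_toMeasurable μ _ h)),
      (measurableSet_toMeasurable _ _).compl, by
        rw [mem_ae_iff, compl_compl, measure_toMeasurable]; exact hv.1⟩ :
      ∃ G : Set Ω, (∀ ω ∈ G, IsStieltjesPath (fun t => B t ω)) ∧ MeasurableSet G ∧ G ∈ ae μ)
  refine ⟨fun ω => if ω ∈ G then doleansKernel T B ω else 0, ?_, ?_⟩
  · have hfin : ∀ ω, IsFiniteMeasure (if ω ∈ G then doleansKernel T B ω else 0) := fun ω => by
      split_ifs
      · unfold doleansKernel; infer_instance
      · infer_instance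
    have hrect : ∀ C ∈ upperRays, ∀ D : Set Ω, MeasurableSet D →
        Measurable fun ω => (if ω ∈ G then doleansKernel T B ω else 0) (C ×ˢ D) := by
      intro C hC D hD
      obtain ⟨u, hu, hCu⟩ : ∃ u : Ω → ℝ≥0∞, Measurable u ∧
          ∀ ω ∈ G, pathMeasure T (fun t => B t ω) C = u ω := by
        rcases hC with rfl | ⟨i, rfl⟩
        · exact ⟨_, ((hB T).sub (hB 0)).ennreal_ofReal, fun ω hω => pathMeasure_univ (hGsub ω hω)⟩
        · exact ⟨_, ((hB T).sub (hB (min i T))).ennreal_ofReal,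
            fun ω hω => pathMeasure_Ioi (hGsub ω hω) i⟩
      have hCm : MeasurableSet C := by
        rcases hC with rfl | ⟨i, rfl⟩
        · exact MeasurableSet.univ
        · exact measurableSet_Ioi
      have heq : (fun ω => (if ω ∈ G then doleansKernel T B ω else 0) (C ×ˢ D)) =
          (G ∩ D).indicator u := by
        ext ω
        by_cases h1 : ω ∈ G
        · rw [if_pos h1, doleansKernel_apply _ _ _ (hCm.prod hD)]
          by_cases h2 : ω ∈ D
          · rw [Set.indicator_of_mem (show ω ∈ G ∩ D from ⟨h1, h2⟩), ← hCu ω h1]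
            congr 1
            ext s; simp [h2]
          · rw [Set.indicator_of_notMem (fun h => h2 h.2)]
            rw [show (fun s => (s, ω)) ⁻¹' C ×ˢ D = ∅ by ext s; simp [h2], measure_empty]
        · rw [if_neg h1, Set.indicator_of_notMem (fun h => h1 h.1)]
          rfl
      rw [heq]
      exact hu.indicator (hG.inter hD)
    refine Measurable.measure_of_isPiSystem generateFrom_upperRays_prod
      (isPiSystem_upperRays.prod MeasurableSpace.isPiSystem_measurableSet) ?_ ?_
    · rintro _ ⟨C, hC, D, hD, rfl⟩
      exact hrect C hC D hD
    · have := hrect Set.univ (Or.inl rfl) Set.univ MeasurableSet.univ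
      rwa [Set.univ_prod_univ] at this
  · filter_upwards [hGnull] with ω hω
    rw [if_pos hω]

section Doleans

variable {T : ℝ≥0} {B : ℝ≥0 → Ω → ℝ}

lemma lintegral_doleans (hB : ∀ t, Measurable (B t))
    (hpath : ∀ᵐ ω ∂μ, IsStieltjesPath (fun t => B t ω)) {f : ℝ≥0 × Ω → ℝ≥0∞} (hf : Measurable f) :
    ∫⁻ x, f x ∂(doleans μ T B) = ∫⁻ ω, ∫⁻ s, f (s, ω) ∂(pathMeasure T fun t => B t ω) ∂μ := by
  rw [doleans, Measure.lintegral_bind (aemeasurable_doleansKernel hB hpath) hf.aemeasurable]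
  refine lintegral_congr fun ω => ?_
  rw [doleansKernel, lintegral_map hf measurable_prodMk_right]

lemma aemeasurable_lintegral_pathMeasure (hB : ∀ t, Measurable (B t))
    (hpath : ∀ᵐ ω ∂μ, IsStieltjesPath (fun t => B t ω)) {f : ℝ≥0 × Ω → ℝ≥0∞} (hf : Measurable f) :
    AEMeasurable (fun ω => ∫⁻ s, f (s, ω) ∂(pathMeasure T fun t => B t ω)) μ := by
  have h := (Measure.measurable_lintegral hf).comp_aemeasurable
    (aemeasurable_doleansKernel (T := T) hB hpath)
  refine h.congr (.of_forall fun ω => ?_)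
  simp only [Function.comp, doleansKernel]
  rw [lintegral_map hf measurable_prodMk_right]

lemma doleans_prod (hB : ∀ t, Measurable (B t))
    (hpath : ∀ᵐ ω ∂μ, IsStieltjesPath (fun t => B t ω)) {C : Set ℝ≥0} (hC : MeasurableSet C)
    {D : Set Ω} (hD : MeasurableSet D) :
    doleans μ T B (C ×ˢ D) = ∫⁻ ω in D, pathMeasure T (fun t => B t ω) C ∂μ := by
  rw [← lintegral_indicator_one (hC.prod hD),
    lintegral_doleans hB hpath (measurable_one.indicator (hC.prod hD)), ← lintegral_indicator hD]
  refine lintegral_congr fun ω => ?_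
  by_cases h : ω ∈ D
  · rw [Set.indicator_of_mem h, ← lintegral_indicator_one hC]
    refine lintegral_congr fun s => ?_
    by_cases hs : s ∈ C <;> simp [hs, h]
  · rw [Set.indicator_of_notMem h]
    simp [Set.indicator, h]

end Doleans

/-! ### Predictable processes -/

section Predictable

variable {ℱ : Filtration ℝ≥0 m} {p q : ℝ≥0 → Ω → ℝ} {T : ℝ≥0}

lemma predictable_le_prod : ℱ.predictable ≤ (Prod.instMeasurableSpace : MeasurableSpace (ℝ≥0 × Ω)) :=
  measurableSpace_le_predictable_of_measurableSet
    (fun _ hA => (measurableSet_singleton _).prod (ℱ.le _ _ hA))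
    (fun i _ hA => measurableSet_Ioi.prod (ℱ.le i _ hA))

lemma isPiSystem_predictable (ℱ : Filtration ℝ≥0 m) : IsPiSystem
    ({s | ∃ A, MeasurableSet[ℱ ⊥] A ∧ s = ({⊥} : Set ℝ≥0) ×ˢ A} ∪
      {s | ∃ i A, MeasurableSet[ℱ i] A ∧ s = Set.Ioi i ×ˢ A}) := by
  rintro _ (⟨A, hA, rfl⟩ | ⟨i, A, hA, rfl⟩) _ (⟨B, hB, rfl⟩ | ⟨j, B, hB, rfl⟩) hne
  · exact Or.inl ⟨A ∩ B, hA.inter hB, by rw [Set.prod_inter_prod, Set.inter_self]⟩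
  · obtain ⟨x, hx⟩ := hne
    have h1 : x.1 = 0 := hx.1.1
    have h2 : j < x.1 := hx.2.1
    simp [h1] at h2
  · obtain ⟨x, hx⟩ := hne
    have h1 : x.1 = 0 := hx.2.1
    have h2 : i < x.1 := hx.1.1
    simp [h1] at h2
  · exact Or.inr ⟨max i j, A ∩ B, (ℱ.mono (le_max_left i j) _ hA).inter
      (ℱ.mono (le_max_right i j) _ hB), by rw [Set.prod_inter_prod, Set.Ioi_inter_Ioi]⟩

/-- An increasing, càdlàg, adapted process that is integrable up to time `T`. -/
structure IsIncreasing (μ : Measure Ω) (ℱ : Filtration ℝ≥0 m) (T : ℝ≥0) (B : ℝ≥0 → Ω → ℝ) : Prop where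
  adapted : StronglyAdapted ℱ B
  integrable : ∀ t ≤ T, Integrable (B t) μ
  cadlag : ∀ᵐ ω ∂μ, IsCadlag (fun t => B t ω)
  mono : ∀ᵐ ω ∂μ, Monotone (fun t => B t ω)

namespace IsIncreasing

lemma path (hp : IsIncreasing μ ℱ T p) : ∀ᵐ ω ∂μ, IsStieltjesPath (fun t => p t ω) := by
  filter_upwards [hp.cadlag, hp.mono] with ω h1 h2 using h1.isStieltjesPath h2

lemma measurable (hp : IsIncreasing μ ℱ T p) (t : ℝ≥0) : Measurable (p t) :=
  ((hp.adapted t).mono (ℱ.le t)).measurable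

lemma add (hp : IsIncreasing μ ℱ T p) (hq : IsIncreasing μ ℱ T q) :
    IsIncreasing μ ℱ T (fun t ω => p t ω + q t ω) where
  adapted t := (hp.adapted t).add (hq.adapted t)
  integrable t ht := (hp.integrable t ht).add (hq.integrable t ht)
  cadlag := by filter_upwards [hp.cadlag, hq.cadlag] with ω h1 h2 using h1.add h2
  mono := by filter_upwards [hp.mono, hq.mono] with ω h1 h2 using h1.add h2

lemma doleans_Ioi_prod (hp : IsIncreasing μ ℱ T p) (i : ℝ≥0) {A : Set Ω} (hA : MeasurableSet A) :
    doleans μ T p (Set.Ioi i ×ˢ A) = ENNReal.ofReal (∫ ω in A, (p T ω - p (min i T) ω) ∂μ) := by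
  rw [doleans_prod hp.measurable hp.path measurableSet_Ioi hA,
    ofReal_integral_eq_lintegral_ofReal (f := fun ω => p T ω - p (min i T) ω)
      ((hp.integrable T le_rfl).sub (hp.integrable (min i T) (min_le_right i T))).integrableOn]
  · refine setLIntegral_congr_fun_ae hA ?_
    filter_upwards [hp.path] with ω hω _ using pathMeasure_Ioi hω i
  · refine ae_restrict_of_ae ?_
    filter_upwards [hp.mono] with ω hω using sub_nonneg.2 (hω (min_le_right i T))

lemma doleans_singleton_prod (hp : IsIncreasing μ ℱ T p) {A : Set Ω} (hA : MeasurableSet A) :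
    doleans μ T p (({⊥} : Set ℝ≥0) ×ˢ A) = 0 := by
  rw [doleans_prod hp.measurable hp.path (measurableSet_singleton _) hA, lintegral_eq_zero_iff']
  · refine ae_restrict_of_ae (.of_forall fun ω => ?_)
    exact measure_mono_null (by simp) (pathMeasure_compl (T := T) _)
  · refine (aemeasurable_const (b := 0)).congr (.of_forall fun ω => ?_)
    exact (measure_mono_null (by simp) (pathMeasure_compl (T := T) _)).symm

lemma doleans_univ (hp : IsIncreasing μ ℱ T p) :
    doleans μ T p Set.univ = ENNReal.ofReal (∫ ω, (p T ω - p 0 ω) ∂μ) := by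
  have h : (Set.univ : Set (ℝ≥0 × Ω)) = (({⊥} : Set ℝ≥0) ×ˢ Set.univ) ∪ (Set.Ioi 0 ×ˢ Set.univ) := by
    ext x
    rcases eq_zero_or_pos x.1 with h | h <;> simp [h]
  rw [h, measure_union _ (measurableSet_Ioi.prod MeasurableSet.univ),
    hp.doleans_singleton_prod MeasurableSet.univ, hp.doleans_Ioi_prod _ MeasurableSet.univ, zero_add]
  · simp
  · rw [Set.disjoint_left]
    rintro x hx hy
    have h1 : x.1 = 0 := hx.1
    have h2 : 0 < x.1 := hy.1
    simp [h1] at h2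

end IsIncreasing

/-- If `p - q` is a martingale, then the Doléans measures of `p` and `q` agree on the predictable
σ-algebra. -/
lemma doleans_trim_eq [IsFiniteMeasure μ] (hp : IsIncreasing μ ℱ T p) (hq : IsIncreasing μ ℱ T q)
    (hM : Martingale (fun t ω => p t ω - q t ω) ℱ μ) :
    (doleans μ T p).trim (predictable_le_prod (ℱ := ℱ)) =
      (doleans μ T q).trim (predictable_le_prod (ℱ := ℱ)) := by
  -- The martingale property tested on `A ∈ ℱ i` is equality of the two Doléans measures on `(i, T]
  -- × A`, and such sets generate the predictable σ-algebra.
  have key : ∀ i ≤ T, ∀ A, MeasurableSet[ℱ i] A →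
      ∫ ω in A, (p T ω - p i ω) ∂μ = ∫ ω in A, (q T ω - q i ω) ∂μ := by
    intro i hi A hA
    have h := hM.setIntegral_eq hi hA
    rw [integral_sub (hp.integrable i hi).integrableOn (hq.integrable i hi).integrableOn,
      integral_sub (hp.integrable T le_rfl).integrableOn (hq.integrable T le_rfl).integrableOn] at h
    rw [integral_sub (hp.integrable T le_rfl).integrableOn (hp.integrable i hi).integrableOn,
      integral_sub (hq.integrable T le_rfl).integrableOn (hq.integrable i hi).integrableOn]
    linarith
  have huniv : doleans μ T p Set.univ = doleans μ T q Set.univ := by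
    rw [hp.doleans_univ, hq.doleans_univ]
    have := key 0 zero_le Set.univ MeasurableSet.univ
    simp only [Measure.restrict_univ] at this
    rw [this]
  have hfin : IsFiniteMeasure ((doleans μ T p).trim (predictable_le_prod (ℱ := ℱ))) := ⟨by
    rw [trim_measurableSet_eq _ MeasurableSet.univ, hp.doleans_univ]
    exact ENNReal.ofReal_lt_top⟩
  refine ext_of_generate_finite _ rfl (isPiSystem_predictable ℱ) ?_ ?_
  · rintro _ (⟨A, hA, rfl⟩ | ⟨i, A, hA, rfl⟩)
    · rw [trim_measurableSet_eq _ (measurableSet_predictable_singleton_bot_prod hA),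
        trim_measurableSet_eq _ (measurableSet_predictable_singleton_bot_prod hA),
        hp.doleans_singleton_prod (ℱ.le _ _ hA), hq.doleans_singleton_prod (ℱ.le _ _ hA)]
    · rw [trim_measurableSet_eq _ (measurableSet_predictable_Ioi_prod hA),
        trim_measurableSet_eq _ (measurableSet_predictable_Ioi_prod hA),
        hp.doleans_Ioi_prod _ (ℱ.le _ _ hA), hq.doleans_Ioi_prod _ (ℱ.le _ _ hA)]
      rcases le_total i T with h | h
      · rw [min_eq_left h, key i h A hA]
      · simp [min_eq_right h]
  · rw [trim_measurableSet_eq _ MeasurableSet.univ, trim_measurableSet_eq _ MeasurableSet.univ, huniv]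

/-- Predictable non-negative processes have the same expected integral against `p` and `q`
if `p - q` is a martingale. -/
lemma lintegral_predictable_eq [IsFiniteMeasure μ] (hp : IsIncreasing μ ℱ T p)
    (hq : IsIncreasing μ ℱ T q) (hM : Martingale (fun t ω => p t ω - q t ω) ℱ μ)
    {f : ℝ≥0 × Ω → ℝ≥0∞} (hf : Measurable[ℱ.predictable] f) :
    ∫⁻ ω, ∫⁻ s, f (s, ω) ∂(pathMeasure T fun t => p t ω) ∂μ =
      ∫⁻ ω, ∫⁻ s, f (s, ω) ∂(pathMeasure T fun t => q t ω) ∂μ := by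
  have hf' : Measurable f := hf.mono predictable_le_prod le_rfl
  rw [← lintegral_doleans hp.measurable hp.path hf', ← lintegral_doleans hq.measurable hq.path hf',
    ← lintegral_trim predictable_le_prod hf, ← lintegral_trim predictable_le_prod hf,
    doleans_trim_eq hp hq hM]

/-! ### Predictable versions of left limits -/

/-- The value of a process at the last grid point strictly before `s`. -/
noncomputable def gridPast (B : ℝ≥0 → Ω → ℝ) (n : ℕ) (x : ℝ≥0 × Ω) : ℝ :=
  B (grid n (gridIdx n x.1)) x.2

lemma measurable_gridPast (hp : StronglyAdapted ℱ p) (n : ℕ) :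
    Measurable[ℱ.predictable] (gridPast p n) := by
  intro U hU
  have : gridPast p n ⁻¹' U = (({⊥} : Set ℝ≥0) ×ˢ (p 0 ⁻¹' U)) ∪
      ⋃ k : ℕ, Set.Ioc (grid n k) (grid n (k + 1)) ×ˢ (p (grid n k) ⁻¹' U) := by
    ext ⟨s, ω⟩
    rcases eq_zero_or_pos s with rfl | hs
    · simp [gridPast, grid_gridIdx_zero]
    · have hs' : s ≠ 0 := hs.ne'
      simp only [Set.mem_preimage, gridPast, Set.mem_union, Set.mem_prod, Set.mem_singleton_iff,
        bot_eq_zero, hs', false_and, false_or, Set.mem_iUnion, mem_Ioc_grid_iff n hs]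
      simp
  rw [this]
  refine MeasurableSet.union (measurableSet_predictable_singleton_bot_prod
    ((hp 0).measurable hU)) (MeasurableSet.iUnion fun k => ?_)
  exact measurableSet_predictable_Ioc_prod _ _ ((hp (grid n k)).measurable hU)

/-- A predictable version of the left-limit process. -/
noncomputable def leftVersion (B : ℝ≥0 → Ω → ℝ) (x : ℝ≥0 × Ω) : ℝ :=
  limUnder atTop (fun n => gridPast B n x)

/-- `limUnder` of measurable functions is measurable without any convergence, so the version is
predictable everywhere, although it is identified with left limits only at positive times of càdlàg
paths. -/
lemma measurable_leftVersion (hp : StronglyAdapted ℱ p) :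
    Measurable[ℱ.predictable] (leftVersion p) := by
  let : MeasurableSpace (ℝ≥0 × Ω) := ℱ.predictable
  exact (StronglyMeasurable.limUnder
    fun n => (measurable_gridPast hp n).stronglyMeasurable).measurable

lemma leftVersion_eq {ω : Ω} (hω : IsCadlag (fun t => p t ω)) {s : ℝ≥0} (hs : 0 < s) :
    leftVersion p (s, ω) = Function.leftLim (fun t => p t ω) s :=
  ((hω.tendsto_leftLim s).comp (tendsto_grid_gridIdx hs)).limUnder_eq

end Predictable

/-! ### Integration by parts for finite measures on the half-line -/

section ByParts

variable {P Q : Measure ℝ≥0} [IsFiniteMeasure P] [IsFiniteMeasure Q]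

/-- Integration by parts is Fubini for `P ⊗ Q` on the square cut into the region below the diagonal,
the region above it, and the diagonal. -/
lemma measure_univ_mul_univ_eq : P Set.univ * Q Set.univ =
    ∫⁻ s, Q (Set.Iio s) ∂P + ∫⁻ s, P (Set.Iio s) ∂Q + ∫⁻ s, Q {s} ∂P := by
  have hA : MeasurableSet {x : ℝ≥0 × ℝ≥0 | x.2 < x.1} := measurableSet_lt measurable_snd measurable_fst
  have hB : MeasurableSet {x : ℝ≥0 × ℝ≥0 | x.1 < x.2} := measurableSet_lt measurable_fst measurable_snd
  have hC : MeasurableSet {x : ℝ≥0 × ℝ≥0 | x.1 = x.2} := measurableSet_eq_fun measurable_fst measurable_snd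
  have hu : (Set.univ : Set (ℝ≥0 × ℝ≥0)) =
      ({x | x.2 < x.1} ∪ {x | x.1 < x.2}) ∪ {x | x.1 = x.2} := by
    ext x
    rcases lt_trichotomy x.1 x.2 with h | h | h <;> simp [h]
  rw [← Measure.prod_prod, Set.univ_prod_univ, hu, measure_union _ hC, measure_union _ hB,
    Measure.prod_apply hA, Measure.prod_apply_symm hB, Measure.prod_apply hC]
  · congr 1
    refine lintegral_congr fun s => congrArg Q ?_
    ext y; simp [eq_comm]
  · rw [Set.disjoint_left]
    intro x h1 h2
    exact lt_asymm (show x.2 < x.1 from h1) (show x.1 < x.2 from h2)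
  · rw [Set.disjoint_left]
    rintro x (h1 | h1) (h2 : x.1 = x.2)
    · exact h2.not_gt h1
    · exact h2.not_lt h1

lemma lintegral_eq_tsum_of_countable {D : Set ℝ≥0} (hD : D.Countable) {f : ℝ≥0 → ℝ≥0∞}
    (hf : ∀ s ∉ D, f s = 0) : ∫⁻ s, f s ∂P = ∑' s : D, f s * P {(s : ℝ≥0)} := by
  rw [← lintegral_countable f hD, ← lintegral_indicator hD.measurableSet]
  refine lintegral_congr fun s => ?_
  by_cases h : s ∈ D
  · rw [Set.indicator_of_mem h]
  · rw [Set.indicator_of_notMem h, hf s h]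

/-- Expansion of `(x - y)²` arranged to avoid subtraction in `ℝ≥0∞`. -/
lemma sq_add_sq_eq_ofReal {x y : ℝ≥0∞} (hx : x ≠ ∞) (hy : y ≠ ∞) :
    x * x + y * y = 2 * (x * y) + ENNReal.ofReal ((x.toReal - y.toReal) ^ 2) := by
  lift x to ℝ≥0 using hx
  lift y to ℝ≥0 using hy
  rw [ENNReal.coe_toReal, ENNReal.coe_toReal, ENNReal.ofReal]
  norm_cast
  rw [← NNReal.coe_inj]
  push_cast
  rw [Real.coe_toNNReal _ (sq_nonneg _)]
  ring

/-- The energy inequality for the difference of two finite measures on the half-line. -/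
lemma sq_measure_sub_add_le {D : Set ℝ≥0} (hD : D.Countable)
    (hP : ∀ s ∉ D, P {s} = 0) (hQ : ∀ s ∉ D, Q {s} = 0) :
    ENNReal.ofReal ((P.real Set.univ - Q.real Set.univ) ^ 2) +
        (2 * ∫⁻ s, Q (Set.Iio s) ∂P + 2 * ∫⁻ s, P (Set.Iio s) ∂Q) ≤
      2 * ∫⁻ s, P (Set.Iio s) ∂P + 2 * ∫⁻ s, Q (Set.Iio s) ∂Q +
        ∑' s, ENNReal.ofReal ((P.real {s} - Q.real {s}) ^ 2) := by
  have hPP := measure_univ_mul_univ_eq (P := P) (Q := P)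
  have hQQ := measure_univ_mul_univ_eq (P := Q) (Q := Q)
  have hPQ := measure_univ_mul_univ_eq (P := P) (Q := Q)
  have hV := sq_add_sq_eq_ofReal (measure_ne_top P Set.univ) (measure_ne_top Q Set.univ)
  have hdiag : ∫⁻ s, P {s} ∂P + ∫⁻ s, Q {s} ∂Q ≤ 2 * ∫⁻ s, Q {s} ∂P +
      ∑' s, ENNReal.ofReal ((P.real {s} - Q.real {s}) ^ 2) := by
    rw [lintegral_eq_tsum_of_countable hD hP, lintegral_eq_tsum_of_countable hD hQ,
      lintegral_eq_tsum_of_countable hD hQ, ← ENNReal.tsum_add, ← ENNReal.tsum_mul_left]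
    have : ∀ s : D, P {(s : ℝ≥0)} * P {(s : ℝ≥0)} + Q {(s : ℝ≥0)} * Q {(s : ℝ≥0)} =
        2 * (Q {(s : ℝ≥0)} * P {(s : ℝ≥0)}) +
          ENNReal.ofReal ((P.real {(s : ℝ≥0)} - Q.real {(s : ℝ≥0)}) ^ 2) := fun s => by
      rw [sq_add_sq_eq_ofReal (measure_ne_top P _) (measure_ne_top Q _), mul_comm (P _) (Q _)]
      rfl
    rw [tsum_congr this, ENNReal.tsum_add]
    gcongr
    exact ENNReal.tsum_comp_le_tsum_of_injective Subtype.val_injective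
      (fun s => ENNReal.ofReal ((P.real {s} - Q.real {s}) ^ 2))
  -- Adding this finite quantity to both sides turns the square of the difference of total masses
  -- into the sum of their squares, to which integration by parts applies.
  have hfin : 2 * (P Set.univ * Q Set.univ) ≠ ∞ :=
    ENNReal.mul_ne_top (by simp) (ENNReal.mul_ne_top (measure_ne_top P _) (measure_ne_top Q _))
  refine (ENNReal.add_le_add_iff_left hfin).1 ?_
  set J := ∑' s, ENNReal.ofReal ((P.real {s} - Q.real {s}) ^ 2)
  rw [← add_assoc]
  change 2 * (P Set.univ * Q Set.univ) +
    ENNReal.ofReal (((P Set.univ).toReal - (Q Set.univ).toReal) ^ 2) + _ ≤ _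
  rw [← hV, hPP, hQQ, hPQ]
  set α := ∫⁻ s, P (Set.Iio s) ∂P
  set β := ∫⁻ s, Q (Set.Iio s) ∂P
  set α' := ∫⁻ s, P (Set.Iio s) ∂Q
  set β' := ∫⁻ s, Q (Set.Iio s) ∂Q
  calc _ = (2 * α + 2 * β' + 2 * β + 2 * α') + (∫⁻ s, P {s} ∂P + ∫⁻ s, Q {s} ∂Q) := by ring
    _ ≤ (2 * α + 2 * β' + 2 * β + 2 * α') + (2 * ∫⁻ s, Q {s} ∂P + J) := by gcongr
    _ = _ := by ring

end ByParts

/-! ### The energy inequality for compensated increasing processes -/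

section Energy

variable {Ω : Type*} [m : MeasurableSpace Ω] {μ : Measure Ω} {ℱ : Filtration ℝ≥0 m}
  {p q : ℝ≥0 → Ω → ℝ} {T : ℝ≥0}

/-- The predictable set on which the left limits of `p` and `q` are at most `n`. -/
def localSet (p q : ℝ≥0 → Ω → ℝ) (n : ℕ) : Set (ℝ≥0 × Ω) :=
  {x | leftVersion p x ≤ n ∧ leftVersion q x ≤ n}

lemma measurableSet_localSet (hp : StronglyAdapted ℱ p) (hq : StronglyAdapted ℱ q) (n : ℕ) :
    MeasurableSet[ℱ.predictable] (localSet p q n) := by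
  let : MeasurableSpace (ℝ≥0 × Ω) := ℱ.predictable
  exact (measurableSet_le (measurable_leftVersion hp) measurable_const).inter
    (measurableSet_le (measurable_leftVersion hq) measurable_const)

/-- The left limits of `p`, localized. -/
noncomputable def localLeft (p q r : ℝ≥0 → Ω → ℝ) (n : ℕ) : ℝ≥0 × Ω → ℝ≥0∞ :=
  (localSet p q n).indicator fun x => ENNReal.ofReal (leftVersion r x)

lemma measurable_localLeft {r : ℝ≥0 → Ω → ℝ} (hp : StronglyAdapted ℱ p) (hq : StronglyAdapted ℱ q)
    (hr : StronglyAdapted ℱ r) (n : ℕ) : Measurable[ℱ.predictable] (localLeft p q r n) := by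
  let : MeasurableSpace (ℝ≥0 × Ω) := ℱ.predictable
  exact (measurable_leftVersion hr).ennreal_ofReal.indicator (measurableSet_localSet hp hq n)

lemma ae_pathMeasure_mem (f : ℝ≥0 → ℝ) : ∀ᵐ s ∂(pathMeasure T f), s ∈ Set.Ioc 0 T :=
  pathMeasure_compl f

/-- On the localizing set, the restricted measure of `[0, s)` is the left limit at `s`. -/
lemma restrict_localSet_Iio {ω : Ω} (hpc : IsCadlag fun t => p t ω) (hpm : Monotone fun t => p t ω)
    (hqc : IsCadlag fun t => q t ω) (hqm : Monotone fun t => q t ω) {r : ℝ≥0 → Ω → ℝ}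
    (hrc : IsCadlag fun t => r t ω) (hrm : Monotone fun t => r t ω) (hr0 : r 0 ω = 0)
    {n : ℕ} {s : ℝ≥0} (hs : s ∈ Set.Ioc 0 T)
    (hsI : (s, ω) ∈ localSet p q n) :
    (pathMeasure T fun t => r t ω).restrict {s | (s, ω) ∈ localSet p q n} (Set.Iio s) =
      ENNReal.ofReal (leftVersion r (s, ω)) := by
  rw [Measure.restrict_apply measurableSet_Iio, leftVersion_eq hrc hs.1]
  have h1 := pathMeasure_Iio (hrc.isStieltjesPath hrm) hs.2
  rw [hr0, sub_zero] at h1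
  rw [← h1]
  refine le_antisymm (measure_mono Set.inter_subset_left) ?_
  -- Left limits of monotone paths increase, so with `s` every earlier positive time lies in the
  -- localizing set; the point `0` carries no mass.
  have hsub : Set.Iio s ⊆ (Set.Iio s ∩ {s | (s, ω) ∈ localSet p q n}) ∪ {0} := by
    intro u hu
    rcases eq_zero_or_pos u with h | h
    · exact Or.inr h
    · refine Or.inl ⟨hu, ?_⟩
      have h2 := hsI.1
      have h3 := hsI.2
      rw [leftVersion_eq hpc hs.1] at h2
      rw [leftVersion_eq hqc hs.1] at h3
      constructor
      · rw [leftVersion_eq hpc h]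
        exact (hpm.leftLim (le_of_lt hu)).trans h2
      · rw [leftVersion_eq hqc h]
        exact (hqm.leftLim (le_of_lt hu)).trans h3
  refine (measure_mono hsub).trans ((measure_union_le _ _).trans ?_)
  rw [pathMeasure_singleton (hrc.isStieltjesPath hrm), pathJump_zero]
  simp

/-- The pathwise form of the localized energy inequality. -/
lemma sq_local_add_le {ω : Ω} (hpc : IsCadlag fun t => p t ω) (hpm : Monotone fun t => p t ω)
    (hqc : IsCadlag fun t => q t ω) (hqm : Monotone fun t => q t ω) (hp0 : p 0 ω = 0)
    (hq0 : q 0 ω = 0) (n : ℕ) (hI : MeasurableSet {s | (s, ω) ∈ localSet p q n}) :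
    ENNReal.ofReal (((pathMeasure T fun t => p t ω).real {s | (s, ω) ∈ localSet p q n} -
          (pathMeasure T fun t => q t ω).real {s | (s, ω) ∈ localSet p q n}) ^ 2) +
        (2 * ∫⁻ s, localLeft p q q n (s, ω) ∂(pathMeasure T fun t => p t ω) +
          2 * ∫⁻ s, localLeft p q p n (s, ω) ∂(pathMeasure T fun t => q t ω)) ≤
      2 * ∫⁻ s, localLeft p q p n (s, ω) ∂(pathMeasure T fun t => p t ω) +
        2 * ∫⁻ s, localLeft p q q n (s, ω) ∂(pathMeasure T fun t => q t ω) +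
        ∑' t : Set.Icc 0 T, ENNReal.ofReal
          ((pathJump (fun t => p t ω) t - pathJump (fun t => q t ω) t) ^ 2) := by
  set I := {s | (s, ω) ∈ localSet p q n} with hIdef
  set P := pathMeasure T fun t => p t ω
  set Q := pathMeasure T fun t => q t ω
  have hsp := hpc.isStieltjesPath hpm
  have hsq := hqc.isStieltjesPath hqm
  have hint : ∀ (r w : ℝ≥0 → Ω → ℝ), IsCadlag (fun t => r t ω) → Monotone (fun t => r t ω) →
      r 0 ω = 0 → ∫⁻ s, localLeft p q r n (s, ω) ∂(pathMeasure T fun t => w t ω) =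
        ∫⁻ s, (pathMeasure T fun t => r t ω).restrict I (Set.Iio s)
          ∂((pathMeasure T fun t => w t ω).restrict I) := by
    intro r w hrc hrm hr0
    rw [← lintegral_indicator hI]
    refine lintegral_congr_ae ?_
    filter_upwards [ae_pathMeasure_mem (T := T) fun t => w t ω] with s hs
    by_cases h : (s, ω) ∈ localSet p q n
    · rw [localLeft, Set.indicator_of_mem h, Set.indicator_of_mem (show s ∈ I from h),
        restrict_localSet_Iio hpc hpm hqc hqm hrc hrm hr0 hs h]
    · rw [localLeft, Set.indicator_of_notMem h, Set.indicator_of_notMem (show s ∉ I from h)]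
  rw [hint q p hqc hqm hq0, hint p q hpc hpm hp0, hint p p hpc hpm hp0, hint q q hqc hqm hq0]
  have hatom : ∀ (f : ℝ≥0 → ℝ), IsStieltjesPath f → ∀ s, pathJump f s = 0 →
      (pathMeasure T f).restrict I {s} = 0 := by
    intro f hf s hs
    refine le_antisymm ((Measure.restrict_apply_le _ _).trans ?_) zero_le
    rw [pathMeasure_singleton hf, hs]
    simp
  have hmain := sq_measure_sub_add_le (P := P.restrict I) (Q := Q.restrict I)
    (D := {s | pathJump (fun t => p t ω) s ≠ 0} ∪ {s | pathJump (fun t => q t ω) s ≠ 0})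
    ((countable_pathJump_ne_zero hsp).union (countable_pathJump_ne_zero hsq))
    (fun s hs => hatom _ hsp s (by by_contra h; exact hs (Or.inl h)))
    (fun s hs => hatom _ hsq s (by by_contra h; exact hs (Or.inr h)))
  rw [measureReal_restrict_apply MeasurableSet.univ, measureReal_restrict_apply MeasurableSet.univ,
    Set.univ_inter] at hmain
  refine hmain.trans ?_
  gcongr
  rw [tsum_subtype (Set.Icc 0 T) (fun t => ENNReal.ofReal
    ((pathJump (fun t => p t ω) t - pathJump (fun t => q t ω) t) ^ 2))]
  refine ENNReal.tsum_le_tsum fun s => ?_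
  rw [measureReal_restrict_apply (measurableSet_singleton s),
    measureReal_restrict_apply (measurableSet_singleton s)]
  by_cases h1 : s ∈ I
  · rw [Set.inter_eq_left.2 (Set.singleton_subset_iff.2 h1)]
    by_cases h2 : s ≤ T
    · rw [Set.indicator_of_mem (show s ∈ Set.Icc 0 T from ⟨zero_le, h2⟩), Measure.real,
        Measure.real, pathMeasure_singleton hsp, pathMeasure_singleton hsq, if_pos h2, if_pos h2,
        ENNReal.toReal_ofReal (pathJump_nonneg hpm s), ENNReal.toReal_ofReal (pathJump_nonneg hqm s)]
    · rw [Measure.real, Measure.real, pathMeasure_singleton hsp, pathMeasure_singleton hsq,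
        if_neg h2, if_neg h2]
      simp
  · rw [Set.singleton_inter_eq_empty.2 h1]
    simp

/-- The pathwise inequality is integrated and the finite integrals of `a` and `b`, which equal those
of `a'` and `b'`, are cancelled. Below these are the stochastic integrals that cancel in
expectation. -/
lemma lintegral_le_of_ae_add_le {V J a a' b b' : Ω → ℝ≥0∞} (ha : AEMeasurable a μ)
    (hb' : AEMeasurable b' μ) (hb : AEMeasurable b μ)
    (h : ∀ᵐ ω ∂μ, V ω + (2 * b ω + 2 * a' ω) ≤ 2 * a ω + 2 * b' ω + J ω)
    (haa' : ∫⁻ ω, a ω ∂μ = ∫⁻ ω, a' ω ∂μ) (hbb' : ∫⁻ ω, b ω ∂μ = ∫⁻ ω, b' ω ∂μ)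
    (hafin : ∫⁻ ω, a ω ∂μ ≠ ∞) (hbfin : ∫⁻ ω, b ω ∂μ ≠ ∞) :
    ∫⁻ ω, V ω ∂μ ≤ ∫⁻ ω, J ω ∂μ := by
  have h1 := lintegral_mono_ae h
  rw [lintegral_add_left' (f := fun ω => 2 * a ω + 2 * b' ω)
      ((ha.const_mul 2).add (hb'.const_mul 2)),
    lintegral_add_left' (ha.const_mul 2), lintegral_const_mul'' _ ha,
    lintegral_const_mul'' _ hb'] at h1
  -- Superadditivity of the lower integral requires no measurability of `V`.
  have h2 := (le_lintegral_add _ _).trans h1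
  rw [lintegral_add_left' (hb.const_mul 2), lintegral_const_mul'' _ hb,
    lintegral_const_mul' _ _ (by simp), ← haa', ← hbb', add_comm (2 * ∫⁻ ω, b ω ∂μ),
    add_comm (∫⁻ ω, V ω ∂μ)] at h2
  refine (ENNReal.add_le_add_iff_left ?_).1 h2
  exact ENNReal.add_ne_top.2 ⟨ENNReal.mul_ne_top (by simp) hafin, ENNReal.mul_ne_top (by simp) hbfin⟩

/-- The second moment at time `T` of a martingale `p - q` of finite variation is bounded by the
expected sum of its squared jumps. -/
theorem lintegral_sq_sub_le [IsFiniteMeasure μ] (hp : IsIncreasing μ ℱ T p)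
    (hq : IsIncreasing μ ℱ T q) (hp0 : ∀ᵐ ω ∂μ, p 0 ω = 0) (hq0 : ∀ᵐ ω ∂μ, q 0 ω = 0)
    (hM : Martingale (fun t ω => p t ω - q t ω) ℱ μ) :
    ∫⁻ ω, ENNReal.ofReal ((p T ω - q T ω) ^ 2) ∂μ ≤
      ∫⁻ ω, ∑' t : Set.Icc 0 T, ENNReal.ofReal
        ((pathJump (fun t => p t ω) t - pathJump (fun t => q t ω) t) ^ 2) ∂μ := by
  set J : Ω → ℝ≥0∞ := fun ω => ∑' t : Set.Icc 0 T, ENNReal.ofReal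
        ((pathJump (fun t => p t ω) t - pathJump (fun t => q t ω) t) ^ 2)
  set P := fun ω => pathMeasure T fun t => p t ω with hPdef
  set Q := fun ω => pathMeasure T fun t => q t ω with hQdef
  set V : ℕ → Ω → ℝ≥0∞ := fun n ω => ENNReal.ofReal
    (((P ω).real {s | (s, ω) ∈ localSet p q n} - (Q ω).real {s | (s, ω) ∈ localSet p q n}) ^ 2)
    with hV
  have hmeasI : ∀ n, MeasurableSet (localSet p q n) := fun n =>
    predictable_le_prod _ (measurableSet_localSet hp.adapted hq.adapted n)
  have hsec : ∀ n ω, MeasurableSet {s | (s, ω) ∈ localSet p q n} := fun n ω =>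
    measurable_prodMk_right (hmeasI n)
  have hmp : ∀ n, Measurable (localLeft p q p n) := fun n =>
    (measurable_localLeft hp.adapted hq.adapted hp.adapted n).mono predictable_le_prod le_rfl
  have hmq : ∀ n, Measurable (localLeft p q q n) := fun n =>
    (measurable_localLeft hp.adapted hq.adapted hq.adapted n).mono predictable_le_prod le_rfl
  -- Localization makes the integrands at most `n`, so these integrals are at most `n` times the
  -- expected total variation, with no square integrability of `p` or `q`.
  have hfin : ∀ (r w : ℝ≥0 → Ω → ℝ), IsIncreasing μ ℱ T w → (∀ n x, localLeft p q r n x ≤ n) →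
      ∀ n, ∫⁻ ω, ∫⁻ s, localLeft p q r n (s, ω) ∂(pathMeasure T fun t => w t ω) ∂μ ≠ ∞ := by
    intro r w hw hb n
    refine ne_top_of_le_ne_top (b := ∫⁻ ω, (n : ℝ≥0∞) * ENNReal.ofReal (w T ω - w 0 ω) ∂μ) ?_ ?_
    · rw [lintegral_const_mul' _ _ (by simp)]
      refine ENNReal.mul_ne_top (by simp) ?_
      exact ((hw.integrable T le_rfl).sub (hw.integrable 0 zero_le)).lintegral_lt_top.ne
    · refine lintegral_mono_ae ?_
      filter_upwards [hw.path] with ω hω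
      refine (lintegral_mono fun s => hb n (s, ω)).trans ?_
      rw [lintegral_const, pathMeasure_univ hω]
  have hbp : ∀ n x, localLeft p q p n x ≤ n := by
    intro n x
    refine Set.indicator_le' (f := fun x => ENNReal.ofReal (leftVersion p x)) (g := fun _ => (n : ℝ≥0∞))
      (fun x hx => ?_) (fun x _ => zero_le) x
    exact ENNReal.ofReal_le_of_le_toReal (by simpa using hx.1)
  have hbq : ∀ n x, localLeft p q q n x ≤ n := by
    intro n x
    refine Set.indicator_le' (f := fun x => ENNReal.ofReal (leftVersion q x)) (g := fun _ => (n : ℝ≥0∞))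
      (fun x hx => ?_) (fun x _ => zero_le) x
    exact ENNReal.ofReal_le_of_le_toReal (by simpa using hx.2)
  have hstep : ∀ n, ∫⁻ ω, V n ω ∂μ ≤ ∫⁻ ω, J ω ∂μ := by
    intro n
    refine lintegral_le_of_ae_add_le
      (aemeasurable_lintegral_pathMeasure (T := T) hp.measurable hp.path (hmp n))
      (aemeasurable_lintegral_pathMeasure (T := T) hq.measurable hq.path (hmq n))
      (aemeasurable_lintegral_pathMeasure (T := T) hp.measurable hp.path (hmq n))
      ?_ (lintegral_predictable_eq (T := T) hp hq hM
        (measurable_localLeft hp.adapted hq.adapted hp.adapted n))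
      (lintegral_predictable_eq (T := T) hp hq hM
        (measurable_localLeft hp.adapted hq.adapted hq.adapted n))
      (hfin p p hp hbp n) (hfin q p hp hbq n)
    filter_upwards [hp.cadlag, hp.mono, hq.cadlag, hq.mono, hp0, hq0] with ω h1 h2 h3 h4 h5 h6
    exact sq_local_add_le h1 h2 h3 h4 h5 h6 n (hsec n ω)
  have hVmeas : ∀ n, AEMeasurable (V n) μ := by
    intro n
    have h : ∀ w : ℝ≥0 → Ω → ℝ, IsIncreasing μ ℱ T w → AEMeasurable (fun ω =>
        (pathMeasure T fun t => w t ω).real {s | (s, ω) ∈ localSet p q n}) μ := by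
      intro w hw
      refine ((aemeasurable_lintegral_pathMeasure (T := T) hw.measurable hw.path
        (measurable_one.indicator (hmeasI n))).ennreal_toReal).congr (.of_forall fun ω => ?_)
      simp only [Measure.real]
      rw [← lintegral_indicator_one (hsec n ω)]
      rfl
    exact (((h p hp).sub (h q hq)).pow_const 2).ennreal_ofReal
  calc ∫⁻ ω, ENNReal.ofReal ((p T ω - q T ω) ^ 2) ∂μ
      ≤ ∫⁻ ω, liminf (fun n => V n ω) atTop ∂μ := by
        refine lintegral_mono_ae ?_
        filter_upwards [hp.cadlag, hp.mono, hq.cadlag, hq.mono, hp0, hq0] with ω h1 h2 h3 h4 h5 h6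
        have hev : ∀ᶠ n : ℕ in atTop, V n ω = ENNReal.ofReal ((p T ω - q T ω) ^ 2) := by
          -- Once `n` exceeds both terminal values, the localizing set contains all of `(0, T]` on
          -- this path, so Fatou removes the localization.
          filter_upwards [eventually_ge_atTop ⌈max (p T ω) (q T ω)⌉₊] with n hn
          have hn' := (Nat.le_ceil _).trans (Nat.cast_le (α := ℝ).2 hn)
          have hsub : Set.Ioc 0 T ⊆ {s | (s, ω) ∈ localSet p q n} := by
            intro s hs
            constructor
            · rw [leftVersion_eq h1 hs.1]
              exact (h2.leftLim_le hs.2).trans ((le_max_left _ _).trans hn')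
            · rw [leftVersion_eq h3 hs.1]
              exact (h4.leftLim_le hs.2).trans ((le_max_right _ _).trans hn')
          have hreal : ∀ f : ℝ≥0 → ℝ, IsCadlag f → Monotone f → f 0 = 0 →
              (pathMeasure T f).real {s | (s, ω) ∈ localSet p q n} = f T := by
            intro f hc hm h0
            rw [Measure.real, measure_eq_measure_of_null_sdiff (s := {s | (s, ω) ∈ localSet p q n})
              (t := Set.univ) (Set.subset_univ _)
              (measure_mono_null (fun s hs => fun h => hs.2 (hsub h)) (pathMeasure_compl f)),
              pathMeasure_univ (hc.isStieltjesPath hm), h0, sub_zero,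
              ENNReal.toReal_ofReal (h0 ▸ hm zero_le)]
          simp only [hV, hPdef, hQdef]
          rw [hreal _ h1 h2 h5, hreal _ h3 h4 h6]
        rw [(tendsto_const_nhds.congr' (EventuallyEq.symm hev)).liminf_eq]
    _ ≤ liminf (fun n => ∫⁻ ω, V n ω ∂μ) atTop := lintegral_liminf_le' hVmeas
    _ ≤ ∫⁻ ω, J ω ∂μ := by
        refine liminf_le_of_le (by isBoundedDefault) fun b hb => ?_
        obtain ⟨n, hn⟩ := hb.exists
        exact hn.trans (hstep n)

end Energy

variable {Ω : Type*} [m : MeasurableSpace Ω] {μ : Measure Ω} {ℱ : Filtration ℝ≥0 m} {T : ℝ≥0}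

/-! ### Compensators do not jump when the claims have no fixed jumps -/

lemma pathMeasure_lintegral_jump {f : ℝ≥0 → ℝ} {A : ℝ≥0 → Ω → ℝ} {ω : Ω}
    (hA : IsCadlag fun t => A t ω) :
    ∫⁻ s, ENNReal.ofReal (A s ω - leftVersion A (s, ω)) ∂(pathMeasure T f) =
      ∫⁻ s, ENNReal.ofReal (pathJump (fun t => A t ω) s) ∂(pathMeasure T f) := by
  refine lintegral_congr_ae ?_
  filter_upwards [ae_pathMeasure_mem (T := T) f] with s hs
  rw [leftVersion_eq hA hs.1]
  rfl

/-- The jump process `ΔA` is predictable, so `E[∑ (ΔA)²] = E[∫ ΔA dA] = E[∫ ΔA dR] ≤ E[∫ ΔA dS] =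
E[∫ ΔA dC] = 0`. The inequality uses that `ΔA` vanishes off a countable set, where `dR` and `dS`
only see jumps; the last equality is continuity of `C`. -/
lemma ae_pathJump_compensator_eq_zero [IsFiniteMeasure μ] {R A S C : ℝ≥0 → Ω → ℝ}
    (hR : IsIncreasing μ ℱ T R) (hA : IsIncreasing μ ℱ T A) (hS : IsIncreasing μ ℱ T S)
    (hC : IsIncreasing μ ℱ T C) (hApred : IsStronglyPredictable ℱ A)
    (hRA : Martingale (fun t ω => R t ω - A t ω) ℱ μ)
    (hSC : Martingale (fun t ω => S t ω - C t ω) ℱ μ)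
    (hCc : ∀ᵐ ω ∂μ, Continuous fun t => C t ω)
    (hle : ∀ᵐ ω ∂μ, ∀ t ≤ T, pathJump (fun s => R s ω) t ≤ pathJump (fun s => S s ω) t) :
    ∀ᵐ ω ∂μ, ∀ t ≤ T, pathJump (fun s => A s ω) t = 0 := by
  set f : ℝ≥0 × Ω → ℝ≥0∞ := fun x => ENNReal.ofReal (A x.1 x.2 - leftVersion A x) with hf
  have hfpred : Measurable[ℱ.predictable] f := by
    let : MeasurableSpace (ℝ≥0 × Ω) := ℱ.predictable
    exact ((StronglyMeasurable.measurable hApred).sub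
      (measurable_leftVersion hA.adapted)).ennreal_ofReal
  have hfm : Measurable f := hfpred.mono predictable_le_prod le_rfl
  have e1 := lintegral_predictable_eq (T := T) hR hA hRA hfpred
  have e2 := lintegral_predictable_eq (T := T) hS hC hSC hfpred
  have e3 : ∫⁻ ω, ∫⁻ s, f (s, ω) ∂(pathMeasure T fun t => C t ω) ∂μ = 0 := by
    rw [lintegral_eq_zero_iff' (aemeasurable_lintegral_pathMeasure hC.measurable hC.path hfm)]
    filter_upwards [hA.cadlag, hA.path, hC.path, hCc] with ω h1 h2 h3 h4
    simp only [hf]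
    rw [pathMeasure_lintegral_jump h1, lintegral_eq_tsum_of_countable (countable_pathJump_ne_zero h2)
      (fun s hs => by rw [not_not.1 hs, ENNReal.ofReal_zero])]
    refine ENNReal.tsum_eq_zero.2 fun s => ?_
    rw [pathMeasure_singleton h3, pathJump_of_continuous h4]
    simp
  have e4 : ∫⁻ ω, ∫⁻ s, f (s, ω) ∂(pathMeasure T fun t => R t ω) ∂μ ≤
      ∫⁻ ω, ∫⁻ s, f (s, ω) ∂(pathMeasure T fun t => S t ω) ∂μ := by
    refine lintegral_mono_ae ?_
    filter_upwards [hA.cadlag, hA.path, hR.path, hS.path, hle] with ω h1 h2 h3 h4 h5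
    simp only [hf]
    rw [pathMeasure_lintegral_jump h1, pathMeasure_lintegral_jump h1,
      lintegral_eq_tsum_of_countable (countable_pathJump_ne_zero h2)
        (fun s hs => by rw [not_not.1 hs, ENNReal.ofReal_zero]),
      lintegral_eq_tsum_of_countable (countable_pathJump_ne_zero h2)
        (fun s hs => by rw [not_not.1 hs, ENNReal.ofReal_zero])]
    refine ENNReal.tsum_le_tsum fun s => ?_
    rw [pathMeasure_singleton h3, pathMeasure_singleton h4]
    split_ifs with hs
    · gcongr
      exact h5 s hs
    · exact le_rfl
  have e5 : ∫⁻ ω, ∫⁻ s, f (s, ω) ∂(pathMeasure T fun t => A t ω) ∂μ = 0 := by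
    rw [← e1]
    exact le_antisymm (e4.trans (by rw [e2, e3])) zero_le
  rw [lintegral_eq_zero_iff' (aemeasurable_lintegral_pathMeasure hA.measurable hA.path hfm)] at e5
  filter_upwards [e5, hA.cadlag, hA.mono, hA.path] with ω h0 h1 h2 h3 t ht
  simp only [hf, Pi.zero_apply] at h0
  rw [pathMeasure_lintegral_jump h1, lintegral_eq_tsum_of_countable (countable_pathJump_ne_zero h3)
      (fun s hs => by rw [not_not.1 hs, ENNReal.ofReal_zero])] at h0
  by_contra hne
  have := ENNReal.tsum_eq_zero.1 h0 ⟨t, hne⟩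
  rw [pathMeasure_singleton h3, if_pos ht, mul_self_eq_zero, ENNReal.ofReal_eq_zero] at this
  exact hne (le_antisymm this (pathJump_nonneg h2 t))

/-! ### The squared jumps of a square-integrable martingale -/

/-- Conditioning on `ℱ a` gives `E[N_a N_b] = E[N_a²]`. Summed over a grid, the right-hand sides
telescope. -/
lemma integral_sq_sub_of_martingale [IsFiniteMeasure μ] {N : ℝ≥0 → Ω → ℝ} (hN : Martingale N ℱ μ)
    {a b : ℝ≥0} (hab : a ≤ b) (ha2 : MemLp (N a) 2 μ) (hb2 : MemLp (N b) 2 μ) :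
    ∫ ω, (N b ω - N a ω) ^ 2 ∂μ = ∫ ω, N b ω ^ 2 ∂μ - ∫ ω, N a ω ^ 2 ∂μ := by
  have hprod : Integrable (fun ω => N a ω * N b ω) μ := ha2.integrable_mul hb2
  have h1 : ∫ ω, N a ω * N b ω ∂μ = ∫ ω, N a ω ^ 2 ∂μ := by
    rw [← integral_condExp (ℱ.le a)]
    refine integral_congr_ae ?_
    filter_upwards [condExp_mul_of_stronglyMeasurable_left (hN.1 a) hprod (hN.integrable b),
      hN.2 a b hab] with ω h1 h2
    change (μ[N a * N b | ℱ a]) ω = _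
    rw [h1, Pi.mul_apply, h2, sq]
  have h2 : (fun ω => (N b ω - N a ω) ^ 2) =
      fun ω => (N b ω ^ 2 + N a ω ^ 2) - 2 * (N a ω * N b ω) := by
    ext ω; ring
  rw [h2, integral_sub (f := fun ω => N b ω ^ 2 + N a ω ^ 2)
      (hb2.integrable_sq.add ha2.integrable_sq) (hprod.const_mul 2),
    integral_add hb2.integrable_sq ha2.integrable_sq, integral_const_mul, h1]
  ring

lemma memLp_two_of_martingale [IsFiniteMeasure μ] {N : ℝ≥0 → Ω → ℝ} (hN : Martingale N ℱ μ)
    {a b : ℝ≥0} (hab : a ≤ b) (hb2 : MemLp (N b) 2 μ) : MemLp (N a) 2 μ :=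
  (memLp_congr_ae (hN.2 a b hab)).1 (hb2.condExp one_le_two)

/-- The expected sum of the squared jumps of a càdlàg martingale up to `T` is bounded by its
second moment at `T`. -/
theorem lintegral_tsum_sq_jump_le [IsFiniteMeasure μ] {N : ℝ≥0 → Ω → ℝ} (hN : Martingale N ℱ μ)
    (hc : ∀ᵐ ω ∂μ, IsCadlag fun t => N t ω) :
    ∫⁻ ω, ∑' t : Set.Icc 0 T, ENNReal.ofReal (pathJump (fun s => N s ω) t ^ 2) ∂μ ≤
      ∫⁻ ω, ENNReal.ofReal (N T ω ^ 2) ∂μ := by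
  by_cases htop : ∫⁻ ω, ENNReal.ofReal (N T ω ^ 2) ∂μ = ∞
  · rw [htop]; exact le_top
  have hasm : ∀ t, AEStronglyMeasurable (N t) μ := fun t => (hN.integrable t).1
  have hsqint : Integrable (fun ω => N T ω ^ 2) μ := by
    refine ⟨(hasm T).pow 2, ?_⟩
    rw [hasFiniteIntegral_iff_ofReal (.of_forall fun ω => sq_nonneg _)]
    exact lt_top_iff_ne_top.2 htop
  have hT2 : MemLp (N T) 2 μ := (memLp_two_iff_integrable_sq (hasm T)).2 hsqint
  have h2 : ∀ t ≤ T, MemLp (N t) 2 μ := fun t ht => memLp_two_of_martingale hN ht hT2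
  have hstep : ∀ n, ∫⁻ ω, ENNReal.ofReal (sqSum (fun s => N s ω) T n) ∂μ ≤
      ∫⁻ ω, ENNReal.ofReal (N T ω ^ 2) ∂μ := by
    intro n
    have hint : ∀ k, Integrable (fun ω => (N (min T (grid n (k + 1))) ω -
        N (min T (grid n k)) ω) ^ 2) μ := fun k =>
      ((h2 _ (min_le_left _ _)).sub (h2 _ (min_le_left _ _))).integrable_sq
    have hval : ∫ ω, sqSum (fun s => N s ω) T n ∂μ = ∫ ω, N T ω ^ 2 ∂μ - ∫ ω, N 0 ω ^ 2 ∂μ := by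
      simp only [sqSum]
      rw [integral_finsetSum _ fun k _ => hint k,
        Finset.sum_congr rfl fun k _ => integral_sq_sub_of_martingale hN
          (min_le_min_left T (grid_mono n k.le_succ)) (h2 _ (min_le_left _ _))
          (h2 _ (min_le_left _ _)),
        Finset.sum_range_sub (fun k => ∫ ω, N (min T (grid n k)) ω ^ 2 ∂μ),
        min_eq_left (le_grid_gridCard T n), grid_zero, min_eq_right zero_le]
    rw [← ofReal_integral_eq_lintegral_ofReal, ← ofReal_integral_eq_lintegral_ofReal hsqint
      (.of_forall fun ω => sq_nonneg _), hval]
    · refine ENNReal.ofReal_le_ofReal (sub_le_self _ (integral_nonneg fun ω => sq_nonneg _))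
    · exact integrable_finsetSum _ fun k _ => hint k
    · exact .of_forall fun ω => Finset.sum_nonneg fun k _ => sq_nonneg _
  calc _ ≤ ∫⁻ ω, liminf (fun n => ENNReal.ofReal (sqSum (fun s => N s ω) T n)) atTop ∂μ := by
        refine lintegral_mono_ae ?_
        filter_upwards [hc] with ω hω using tsum_sq_pathJump_le_liminf hω T
    _ ≤ liminf (fun n => ∫⁻ ω, ENNReal.ofReal (sqSum (fun s => N s ω) T n) ∂μ) atTop := by
        refine lintegral_liminf_le' fun n => ?_
        refine (AEMeasurable.ennreal_ofReal ?_)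
        simp only [sqSum]
        exact Finset.aemeasurable_fun_sum _ fun k _ =>
          (((hasm _).aemeasurable.sub (hasm _).aemeasurable).pow_const 2)
    _ ≤ _ := by
        refine liminf_le_of_le (by isBoundedDefault) fun b hb => ?_
        obtain ⟨n, hn⟩ := hb.exists
        exact hn.trans (hstep n)

/-! ### Optimal transport on the line along a monotone Lipschitz map -/

section Transport

variable {Φ : ℝ → ℝ}

/-- The primitive of `Φ`. -/
noncomputable def potential (Φ : ℝ → ℝ) (z : ℝ) : ℝ := ∫ x in (0 : ℝ)..z, Φ x

lemma hasDerivAt_potential (hc : Continuous Φ) (z : ℝ) : HasDerivAt (potential Φ) (Φ z) z :=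
  intervalIntegral.integral_hasDerivAt_right (hc.intervalIntegrable _ _)
    (hc.stronglyMeasurableAtFilter _ _) hc.continuousAt

lemma continuous_potential (hc : Continuous Φ) : Continuous (potential Φ) :=
  continuous_iff_continuousAt.2 fun z => (hasDerivAt_potential hc z).continuousAt

/-- The potential is convex with derivative `Φ`, and this is its tangent-line inequality at `w`. -/
lemma sub_mul_le_potential_sub (hc : Continuous Φ) (hm : Monotone Φ) (z w : ℝ) :
    (z - w) * Φ w ≤ potential Φ z - potential Φ w := by
  have hii : ∀ a b : ℝ, IntervalIntegrable Φ volume a b := fun a b => hc.intervalIntegrable a b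
  rw [potential, potential, intervalIntegral.integral_interval_sub_left (hii _ _) (hii _ _)]
  rcases le_total w z with h | h
  · have := intervalIntegral.integral_mono_on h (intervalIntegrable_const (c := Φ w)) (hii w z)
      fun x hx => hm hx.1
    simpa using this
  · have := intervalIntegral.integral_mono_on h (hii z w) (intervalIntegrable_const (c := Φ w))
      fun x hx => hm hx.2
    rw [intervalIntegral.integral_symm]
    simp at this
    linarith

lemma abs_le_of_lipschitz (hl : LipschitzWith 1 Φ) (z : ℝ) : |Φ z| ≤ |Φ 0| + |z| := by
  have := hl.dist_le_mul z 0
  simp only [Real.dist_eq, NNReal.coe_one, one_mul, sub_zero] at this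
  have h2 := abs_sub_abs_le_abs_sub (Φ z) (Φ 0)
  linarith

lemma abs_potential_le (hm : Monotone Φ) (hl : LipschitzWith 1 Φ) (z : ℝ) :
    |potential Φ z| ≤ |z| * (|Φ 0| + |z|) := by
  have h1 := sub_mul_le_potential_sub hl.continuous hm z 0
  have h2 := sub_mul_le_potential_sub hl.continuous hm 0 z
  have h0 : potential Φ 0 = 0 := by simp [potential]
  have hz := abs_le_of_lipschitz hl z
  rw [h0] at h1 h2
  have h3 : |z * Φ 0| ≤ |z| * (|Φ 0| + |z|) := by
    rw [abs_mul]; gcongr; linarith [abs_nonneg z]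
  have h4 : |z * Φ z| ≤ |z| * (|Φ 0| + |z|) := by
    rw [abs_mul]; gcongr
  rw [abs_le] at h3 h4 ⊢
  constructor <;> linarith

/-- The convex conjugate of the primitive of `Φ`. -/
noncomputable def conjugate (Φ : ℝ → ℝ) (y : ℝ) : ℝ := ⨆ r : ℚ, ((r : ℝ) * y - potential Φ r)

/-- The supremum runs over `ℚ` so that it is countable. Where it is unbounded the real supremum is
the default `0`, so the Young inequality below is restricted to the range of `Φ`. -/
lemma measurable_conjugate : Measurable (conjugate Φ) :=
  Measurable.iSup fun _ => (measurable_const.mul measurable_id).sub measurable_const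

/-- By the tangent-line inequality the supremum over `ℝ` is attained at `w`; density of `ℚ` and
continuity of the potential recover it from rational points. -/
lemma conjugate_apply (hc : Continuous Φ) (hm : Monotone Φ) (w : ℝ) :
    conjugate Φ (Φ w) = w * Φ w - potential Φ w := by
  have hle : ∀ z : ℝ, z * Φ w - potential Φ z ≤ w * Φ w - potential Φ w := fun z => by
    have := sub_mul_le_potential_sub hc hm z w
    linarith [sub_mul z w (Φ w)]
  have hbdd : BddAbove (Set.range fun r : ℚ => (r : ℝ) * Φ w - potential Φ r) :=
    ⟨_, by rintro _ ⟨r, rfl⟩; exact hle r⟩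
  refine le_antisymm (ciSup_le fun r => hle r) ?_
  have hcont : Continuous fun z : ℝ => z * Φ w - potential Φ z :=
    (continuous_id.mul continuous_const).sub (continuous_potential hc)
  have hclosed : IsClosed {z : ℝ | z * Φ w - potential Φ z ≤ conjugate Φ (Φ w)} :=
    isClosed_le hcont continuous_const
  have hdense : DenseRange ((↑) : ℚ → ℝ) := Rat.denseRange_cast
  have hsub : Set.range ((↑) : ℚ → ℝ) ⊆ {z : ℝ | z * Φ w - potential Φ z ≤ conjugate Φ (Φ w)} := by
    rintro _ ⟨r, rfl⟩
    exact le_ciSup hbdd r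
  exact (hclosed.closure_subset_iff.2 hsub) (hdense w)

lemma mul_le_potential_add_conjugate (hc : Continuous Φ) (hm : Monotone Φ) (z : ℝ) {y : ℝ}
    (hy : y ∈ Set.range Φ) : z * y ≤ potential Φ z + conjugate Φ y := by
  obtain ⟨w, rfl⟩ := hy
  rw [conjugate_apply hc hm]
  linarith [sub_mul_le_potential_sub hc hm z w, sub_mul z w (Φ w)]

/-- Equality in Young's inequality makes `z` a maximum of `w ↦ w * y - potential Φ w`, whose
derivative there is `y - Φ z`. This gives uniqueness of the transport. -/
lemma eq_of_potential_add_conjugate_eq (hc : Continuous Φ) (hm : Monotone Φ) {z y : ℝ}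
    (hy : y ∈ Set.range Φ) (h : potential Φ z + conjugate Φ y = z * y) : y = Φ z := by
  have hmax : IsLocalMax (fun w : ℝ => w * y - potential Φ w) z := .of_forall fun w => by
    have := mul_le_potential_add_conjugate hc hm w hy
    simp only
    linarith
  have hd := ((hasDerivAt_id z).mul_const y).sub (hasDerivAt_potential hc z)
  have := hmax.hasDerivAt_eq_zero hd
  linarith

variable {Ω : Type*} [MeasurableSpace Ω] {μ : Measure Ω} {Y Z : Ω → ℝ}

lemma memLp_two_comp_lipschitz [IsFiniteMeasure μ] (hl : LipschitzWith 1 Φ) (hZ : MemLp Z 2 μ) :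
    MemLp (fun ω => Φ (Z ω)) 2 μ := by
  refine MemLp.of_le ((memLp_const |Φ 0|).add hZ.norm)
    (hl.continuous.comp_aestronglyMeasurable hZ.1) (.of_forall fun ω => ?_)
  refine (abs_le_of_lipschitz hl (Z ω)).trans (le_of_eq ?_)
  rw [Real.norm_eq_abs, Pi.add_apply, Real.norm_eq_abs,
    abs_of_nonneg (add_nonneg (abs_nonneg (Φ 0)) (abs_nonneg (Z ω)))]

/-- `Y` and `Φ(Z)` have equal second moments and equal means of the conjugate, and Young's
inequality is an equality for `Φ(Z)`. Hence the excess cost of `Y` is twice its expected Young gap.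
-/
lemma integral_sq_sub_sub_eq [IsFiniteMeasure μ] (hm : Monotone Φ) (hl : LipschitzWith 1 Φ)
    (hZ : MemLp Z 2 μ) (hY : IdentDistrib Y (fun ω => Φ (Z ω)) μ μ) :
    Integrable (fun ω => potential Φ (Z ω) + conjugate Φ (Y ω) - Z ω * Y ω) μ ∧
      ∫ ω, (Y ω - Z ω) ^ 2 ∂μ - ∫ ω, (Φ (Z ω) - Z ω) ^ 2 ∂μ =
        2 * ∫ ω, (potential Φ (Z ω) + conjugate Φ (Y ω) - Z ω * Y ω) ∂μ := by
  have hc := hl.continuous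
  have hΦ2 := memLp_two_comp_lipschitz hl hZ
  have hY2 : MemLp Y 2 μ := hY.symm.memLp_snd hΦ2
  have hpot : Integrable (fun ω => potential Φ (Z ω)) μ := by
    refine Integrable.mono' (((hZ.integrable one_le_two).norm.mul_const |Φ 0|).add
      hZ.integrable_sq) ((continuous_potential hc).comp_aestronglyMeasurable hZ.1)
      (.of_forall fun ω => (abs_potential_le hm hl (Z ω)).trans (le_of_eq ?_))
    rw [Pi.add_apply, Real.norm_eq_abs, mul_add, abs_mul_abs_self, sq]
  have hZΦ : Integrable (fun ω => Z ω * Φ (Z ω)) μ := hZ.integrable_mul hΦ2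
  have hZY : Integrable (fun ω => Z ω * Y ω) μ := hZ.integrable_mul hY2
  have hconj := hY.comp (measurable_conjugate (Φ := Φ))
  have hconjΦ : (conjugate Φ ∘ fun ω => Φ (Z ω)) = fun ω => Z ω * Φ (Z ω) - potential Φ (Z ω) := by
    ext ω; exact conjugate_apply hc hm (Z ω)
  have hconjY : Integrable (fun ω => conjugate Φ (Y ω)) μ :=
    hconj.symm.integrable_snd (by rw [hconjΦ]; exact hZΦ.sub hpot)
  have hval : ∫ ω, conjugate Φ (Y ω) ∂μ =
      ∫ ω, Z ω * Φ (Z ω) ∂μ - ∫ ω, potential Φ (Z ω) ∂μ := by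
    have := hconj.integral_eq
    rw [hconjΦ, integral_sub hZΦ hpot] at this
    exact this
  have hsq : ∫ ω, Y ω ^ 2 ∂μ = ∫ ω, Φ (Z ω) ^ 2 ∂μ :=
    (hY.comp (measurable_id.pow_const 2)).integral_eq
  refine ⟨(hpot.add hconjY).sub hZY, ?_⟩
  have e1 : ∀ W : Ω → ℝ, MemLp W 2 μ → ∫ ω, (W ω - Z ω) ^ 2 ∂μ =
      ∫ ω, W ω ^ 2 ∂μ + ∫ ω, Z ω ^ 2 ∂μ - 2 * ∫ ω, Z ω * W ω ∂μ := by
    intro W hW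
    have hZW : Integrable (fun ω => Z ω * W ω) μ := hZ.integrable_mul hW
    have : (fun ω => (W ω - Z ω) ^ 2) = fun ω => (W ω ^ 2 + Z ω ^ 2) - 2 * (Z ω * W ω) := by
      ext ω; ring
    rw [this, integral_sub (f := fun ω => W ω ^ 2 + Z ω ^ 2)
      (hW.integrable_sq.add hZ.integrable_sq) (hZW.const_mul 2),
      integral_add hW.integrable_sq hZ.integrable_sq, integral_const_mul]
  rw [e1 Y hY2, e1 _ hΦ2, integral_sub (f := fun ω => potential Φ (Z ω) + conjugate Φ (Y ω))
    (hpot.add hconjY) hZY, integral_add hpot hconjY, hval, hsq]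
  ring

/-- The range of a continuous function is an interval, hence Borel, so membership passes between
variables of equal law. -/
lemma ae_mem_range_of_identDistrib (hc : Continuous Φ)
    (hY : IdentDistrib Y (fun ω => Φ (Z ω)) μ μ) : ∀ᵐ ω ∂μ, Y ω ∈ Set.range Φ :=
  hY.symm.ae_snd (p := fun y => y ∈ Set.range Φ)
    (isPreconnected_range hc).ordConnected.measurableSet (.of_forall fun ω => ⟨Z ω, rfl⟩)

/-- Among all `Y` with the law of `Φ(Z)`, the variable `Φ(Z)` is the closest to `Z` in `L²`. -/
lemma integral_sq_map_sub_le [IsFiniteMeasure μ] (hm : Monotone Φ) (hl : LipschitzWith 1 Φ)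
    (hZ : MemLp Z 2 μ) (hY : IdentDistrib Y (fun ω => Φ (Z ω)) μ μ) :
    ∫ ω, (Φ (Z ω) - Z ω) ^ 2 ∂μ ≤ ∫ ω, (Y ω - Z ω) ^ 2 ∂μ := by
  have h := (integral_sq_sub_sub_eq hm hl hZ hY).2
  have h0 : 0 ≤ ∫ ω, (potential Φ (Z ω) + conjugate Φ (Y ω) - Z ω * Y ω) ∂μ := by
    refine integral_nonneg_of_ae ?_
    filter_upwards [ae_mem_range_of_identDistrib hl.continuous hY] with ω hω
    exact sub_nonneg.2 (mul_le_potential_add_conjugate hl.continuous hm _ hω)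
  linarith

/-- The minimizer in `integral_sq_map_sub_le` is unique. -/
lemma ae_eq_of_integral_sq_sub_le [IsFiniteMeasure μ] (hm : Monotone Φ) (hl : LipschitzWith 1 Φ)
    (hZ : MemLp Z 2 μ) (hY : IdentDistrib Y (fun ω => Φ (Z ω)) μ μ)
    (hle : ∫ ω, (Y ω - Z ω) ^ 2 ∂μ ≤ ∫ ω, (Φ (Z ω) - Z ω) ^ 2 ∂μ) :
    Y =ᵐ[μ] fun ω => Φ (Z ω) := by
  obtain ⟨hint, h⟩ := integral_sq_sub_sub_eq hm hl hZ hY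
  have hnn : 0 ≤ᵐ[μ] fun ω => potential Φ (Z ω) + conjugate Φ (Y ω) - Z ω * Y ω := by
    filter_upwards [ae_mem_range_of_identDistrib hl.continuous hY] with ω hω
    exact sub_nonneg.2 (mul_le_potential_add_conjugate hl.continuous hm _ hω)
  have h0 : ∫ ω, (potential Φ (Z ω) + conjugate Φ (Y ω) - Z ω * Y ω) ∂μ = 0 :=
    le_antisymm (by linarith) (integral_nonneg_of_ae hnn)
  filter_upwards [(integral_eq_zero_iff_of_nonneg_ae hnn hint).1 h0,
    ae_mem_range_of_identDistrib hl.continuous hY] with ω h1 h2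
  exact eq_of_potential_add_conjugate_eq hl.continuous hm h2 (sub_eq_zero.1 h1)

end Transport

/-! ### Independent increments and conditional expectations -/

section Independence

variable {Ω : Type*} [m : MeasurableSpace Ω] {μ : Measure Ω}

/-- The times `0, e 0, …, e (n - 1), t, u, u, …`. -/
noncomputable def extendTimes {t : ℝ≥0} {n : ℕ} (e : Fin n → Set.Iic t) (u : ℝ≥0) (k : ℕ) : ℝ≥0 :=
  if k = 0 then 0 else if h : k - 1 < n then e ⟨k - 1, h⟩ else if k = n + 1 then t else u

lemma extendTimes_mono {t : ℝ≥0} {n : ℕ} {e : Fin n → Set.Iic t} (he : Monotone e) {u : ℝ≥0}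
    (htu : t ≤ u) : Monotone (extendTimes e u) := by
  refine monotone_nat_of_le_succ fun k => ?_
  unfold extendTimes
  rcases Nat.eq_zero_or_pos k with rfl | hk
  · simp
  · have hk' : k ≠ 0 := hk.ne'
    rw [if_neg hk', if_neg (Nat.succ_ne_zero k)]
    by_cases h1 : k + 1 - 1 < n
    · rw [dif_pos (by omega : k - 1 < n), dif_pos h1]
      exact he (by simp)
    · rw [dif_neg h1]
      by_cases h2 : k - 1 < n
      · rw [dif_pos h2, if_pos (show k + 1 = n + 1 by omega)]
        exact (e _).2
      · rw [dif_neg h2, if_neg (show ¬ k + 1 = n + 1 by omega)]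
        split_ifs
        · exact htu
        · exact le_rfl

/-- The past of a process with independent increments started at `0` is independent of the
future increments. -/
lemma indepFun_past_increment [IsProbabilityMeasure μ] {S : ℝ≥0 → Ω → ℝ}
    (hS : ∀ t, Measurable (S t)) (hI : HasIndepIncrements S μ) (h0 : ∀ᵐ ω ∂μ, S 0 ω = 0)
    {t u : ℝ≥0} (htu : t ≤ u) :
    IndepFun (fun ω (i : Set.Iic t) => S i ω) (fun ω => S u ω - S t ω) μ := by
  refine IndepFun.process_indepFun (X := fun (i : Set.Iic t) ω => S i ω) (fun i => hS i)
    ((hS u).sub (hS t)) fun I => ?_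
  set n := I.card with hn
  set e := I.orderIsoOfFin hn.symm with he
  set τ := extendTimes (fun j => (e j : Set.Iic t)) u with hτdef
  have hτ : Monotone τ := extendTimes_mono (fun a b hab => e.monotone hab) htu
  have hinc := hI.nat hτ
  -- Increments `0, …, n` of `τ` lead from `0` to `t` and determine the past; increment `n + 1`
  -- leads from `t` to `u`.
  have hdisj : Disjoint (Finset.range (n + 1)) {n + 1} := by simp
  have h1 := hinc.indepFun_finset _ _ hdisj
    (fun k => (hS (τ (k + 1))).sub (hS (τ k)))
  have hψ : Measurable fun x : ({n + 1} : Finset ℕ) → ℝ => x ⟨n + 1, by simp⟩ :=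
    measurable_pi_apply _
  -- Past values are partial sums of increments from `S 0 = 0`; the shift by one reflects `τ (j + 1)
  -- = e j`.
  have h2 := h1.comp
    (φ := fun (x : Finset.range (n + 1) → ℝ) (i : I) =>
      ∑ k : Finset.range (n + 1), if (k : ℕ) < (e.symm i : ℕ) + 1 then x k else 0)
    (ψ := fun x : ({n + 1} : Finset ℕ) → ℝ => x ⟨n + 1, by simp⟩)
    (measurable_pi_lambda _ fun i => Finset.measurable_fun_sum _ fun k _ => by
      split_ifs
      · exact measurable_pi_apply k
      · exact measurable_const)
    hψ
  refine h2.congr ?_ (.of_forall fun ω => ?_)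
  · filter_upwards [h0] with ω hω
    ext i
    simp only [Function.comp]
    have hlt : (e.symm i : ℕ) + 1 ≤ n + 1 := by have := (e.symm i).2; omega
    rw [Finset.sum_coe_sort (Finset.range (n + 1)) (fun k => if k < (e.symm i : ℕ) + 1 then
      S (τ (k + 1)) ω - S (τ k) ω else 0), ← Finset.sum_filter]
    have hfil : (Finset.range (n + 1)).filter (· < (e.symm i : ℕ) + 1) =
        Finset.range ((e.symm i : ℕ) + 1) := by
      ext k; simp only [Finset.mem_filter, Finset.mem_range]; omega
    rw [hfil, Finset.sum_range_sub (fun k => S (τ k) ω)]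
    have e0 : τ 0 = 0 := by simp [hτdef, extendTimes]
    have e1 : τ ((e.symm i : ℕ) + 1) = ((i : Set.Iic t) : ℝ≥0) := by
      simp only [hτdef, extendTimes, Nat.succ_ne_zero, if_false, Nat.add_sub_cancel]
      rw [dif_pos (e.symm i).2]
      simp
    rw [e0, e1, hω, sub_zero]
  · have e1 : τ (n + 1 + 1) = u := by simp [hτdef, extendTimes]
    have e2 : τ (n + 1) = t := by simp [hτdef, extendTimes]
    simp [Function.comp, e1, e2]

end Independence

/-- Conditional expectation of a function of the sum of a known and an independent variable. -/
lemma condExp_comp_add_of_indep {Ω : Type*} {ℋ m : MeasurableSpace Ω} {μ : Measure Ω}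
    [IsProbabilityMeasure μ] (hℋ : ℋ ≤ m)
    {Y D : Ω → ℝ} (hY : Measurable[ℋ] Y) (hD : Measurable D)
    (hind : Indep ℋ (MeasurableSpace.comap D inferInstance) μ) {G : ℝ → ℝ} (hG : Continuous G)
    (hint : Integrable (fun ω => G (Y ω + D ω)) μ)
    (hmeas : Continuous fun y => ∫ ω', G (y + D ω') ∂μ) :
    (fun ω => ∫ ω', G (Y ω + D ω') ∂μ) =ᵐ[μ] μ[fun ω => G (Y ω + D ω) | ℋ] := by
  have hY' : Measurable Y := hY.mono hℋ le_rfl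
  have key : ∀ A, MeasurableSet[ℋ] A →
      Integrable (A.indicator fun ω => ∫ ω', G (Y ω + D ω') ∂μ) μ ∧
      ∫ ω, A.indicator (fun ω => ∫ ω', G (Y ω + D ω') ∂μ) ω ∂μ =
        ∫ ω, A.indicator (fun ω => G (Y ω + D ω)) ω ∂μ := by
    intro A hA
    -- Carrying the indicator of `A` along with `Y` reduces the integral over `A` to Fubini for the
    -- product law of `V` and `D`.
    set V : Ω → ℝ × ℝ := fun ω => (A.indicator (fun _ => (1 : ℝ)) ω, Y ω) with hV
    have hVℋ : Measurable[ℋ] V := (measurable_const.indicator hA).prodMk hY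
    have hVm : Measurable V := hVℋ.mono hℋ le_rfl
    have hVD : IndepFun V D μ :=
      (IndepFun_iff_Indep _ _ _).2 (indep_of_indep_of_le_left hind hVℋ.comap_le)
    have hmap := (indepFun_iff_map_prod_eq_prod_map_map hVm.aemeasurable hD.aemeasurable).1 hVD
    set f : (ℝ × ℝ) × ℝ → ℝ := fun x => x.1.1 * G (x.1.2 + x.2) with hf
    have hfm : Measurable f := by
      have := hG.measurable
      fun_prop
    have hfeq : ∀ ω, f (V ω, D ω) = A.indicator (fun ω => G (Y ω + D ω)) ω := fun ω => by
      by_cases h : ω ∈ A <;> simp [hf, hV, h]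
    have hfint : Integrable f ((μ.map V).prod (μ.map D)) := by
      rw [← hmap, integrable_map_measure hfm.aestronglyMeasurable (hVm.prodMk hD).aemeasurable]
      exact (hint.indicator (hℋ _ hA)).congr (.of_forall fun ω => (hfeq ω).symm)
    have hinner : ∀ v : ℝ × ℝ, ∫ d, f (v, d) ∂(μ.map D) = v.1 * ∫ ω', G (v.2 + D ω') ∂μ := by
      intro v
      have hv : Measurable fun d => f (v, d) := hfm.comp measurable_prodMk_left
      rw [integral_map hD.aemeasurable hv.aestronglyMeasurable]
      simp only [hf]
      rw [integral_const_mul]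
    have hAeq : ∀ ω, (V ω).1 * ∫ ω', G ((V ω).2 + D ω') ∂μ =
        A.indicator (fun ω => ∫ ω', G (Y ω + D ω') ∂μ) ω := fun ω => by
      by_cases h : ω ∈ A <;> simp [hV, h]
    have hgm : Measurable fun v : ℝ × ℝ => v.1 * ∫ ω', G (v.2 + D ω') ∂μ :=
      measurable_fst.mul (hmeas.measurable.comp measurable_snd)
    constructor
    · have h1 := hfint.integral_prod_left
      simp_rw [hinner] at h1
      rw [integrable_map_measure hgm.aestronglyMeasurable hVm.aemeasurable] at h1
      exact h1.congr (.of_forall hAeq)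
    · have h1 := integral_prod f hfint
      simp_rw [hinner] at h1
      rw [← hmap, integral_map (hVm.prodMk hD).aemeasurable hfm.aestronglyMeasurable,
        integral_map hVm.aemeasurable hgm.aestronglyMeasurable] at h1
      simp_rw [hfeq, hAeq] at h1
      exact h1.symm
  refine ae_eq_condExp_of_forall_setIntegral_eq hℋ hint (fun A hA _ => ?_) (fun A hA _ => ?_) ?_
  · exact (integrable_indicator_iff (hℋ _ hA)).1 (key A hA).1
  · rw [← integral_indicator (hℋ _ hA), ← integral_indicator (hℋ _ hA)]
    exact (key A hA).2
  · exact (hmeas.measurable.comp hY).stronglyMeasurable.aestronglyMeasurable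

/-! ### The value function of the surplus model -/

namespace SurplusModel

variable {Ω : Type*} [m : MeasurableSpace Ω] {μ : Measure Ω} (X : SurplusModel μ)

/-- The expected cumulative claims. -/
noncomputable def meanClaims (t : ℝ≥0) : ℝ := ∫ ω, X.S t ω ∂μ

lemma S_eq (t : ℝ≥0) (ω : Ω) : X.S t ω = X.meanClaims t - X.M t ω := by
  simp [M, meanClaims]

lemma adapted_M : StronglyAdapted X.filtration X.M := Filtration.stronglyAdapted_natural _

lemma adapted_S : StronglyAdapted X.filtration X.S := fun t => by
  have h : X.S t = fun ω => X.meanClaims t - X.M t ω := funext fun ω => X.S_eq t ω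
  rw [h]
  exact stronglyMeasurable_const.sub (X.adapted_M t)

lemma measurable_M (t : ℝ≥0) : Measurable (X.M t) := (X.stronglyMeasurable_M t).measurable

lemma ae_path : ∀ᵐ ω ∂μ, IsPureJumpPath (fun t => X.S t ω) := X.pureJump.ae_isPureJumpPath

lemma ae_zero : ∀ᵐ ω ∂μ, X.S 0 ω = 0 := X.pureJump.zero

lemma filtration_le_comap (t : ℝ≥0) : X.filtration t ≤
    MeasurableSpace.comap (fun ω (i : Set.Iic t) => X.S i ω) MeasurableSpace.pi := by
  refine iSup₂_le fun j hj => ?_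
  rw [← measurable_iff_comap_le]
  have h : X.M j = fun ω => X.meanClaims j - X.S j ω := funext fun ω => by rw [X.S_eq]; ring
  rw [h]
  exact measurable_const.sub ((measurable_pi_apply (⟨j, hj⟩ : Set.Iic t)).comp
    (comap_measurable (fun ω (i : Set.Iic t) => X.S i ω)))

lemma isIncreasing_S (T : ℝ≥0) : IsIncreasing μ X.filtration T X.S where
  adapted := X.adapted_S
  integrable t _ := X.integrable_S t
  cadlag := X.pureJump.cadlag
  mono := X.pureJump.mono

lemma meanClaims_mono : Monotone X.meanClaims := fun s t hst =>
  integral_mono_ae (X.integrable_S s) (X.integrable_S t)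
    (by filter_upwards [X.pureJump.mono] with ω hω using hω hst)

lemma meanClaims_zero : X.meanClaims 0 = 0 := by
  rw [meanClaims, integral_congr_ae X.ae_zero, integral_zero]

lemma ae_continuousAt (t : ℝ≥0) : ∀ᵐ ω ∂μ, ContinuousAt (fun s => X.S s ω) t := by
  filter_upwards [X.ae_path, X.no_fixed_jump t] with ω h1 h2
  rw [continuousAt_iff_continuous_left_right]
  refine ⟨?_, (h1.cadlag t).1⟩
  rw [← continuousWithinAt_Iio_iff_Iic]
  have h3 := h1.cadlag.tendsto_leftLim t
  rwa [← sub_eq_zero.1 h2] at h3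

/-- Without fixed jumps, paths are almost surely continuous at each given `t`; near `t` they are
dominated by `S (t + 1)`. -/
lemma continuous_meanClaims : Continuous X.meanClaims := by
  refine continuous_iff_continuousAt.2 fun t => ?_
  refine tendsto_integral_filter_of_dominated_convergence (X.S (t + 1))
    (.of_forall fun s => (X.measurable_S s).aestronglyMeasurable) ?_ (X.integrable_S _)
    (X.ae_continuousAt t)
  filter_upwards [Iio_mem_nhds (lt_add_one t)] with s hs
  filter_upwards [X.ae_path] with ω h1
  rw [Real.norm_of_nonneg (h1.zero ▸ h1.mono zero_le)]
  exact h1.mono (le_of_lt hs)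

variable [IsProbabilityMeasure μ]

lemma indep_filtration {t u : ℝ≥0} (htu : t ≤ u) : Indep (X.filtration t)
    (MeasurableSpace.comap (fun ω => X.S u ω - X.S t ω) inferInstance) μ :=
  indep_of_indep_of_le_left ((IndepFun_iff_Indep _ _ _).1 (indepFun_past_increment X.measurable_S
    X.indepIncrements X.ae_zero htu)) (X.filtration_le_comap t)

lemma martingale_M : Martingale X.M X.filtration μ := by
  refine ⟨X.adapted_M, fun s t hst => ?_⟩
  have hint : ∀ u, Integrable (X.M u) μ := fun u => (integrable_const _).sub (X.integrable_S u)
  have hinc : Integrable (fun ω => X.S t ω - X.S s ω) μ := (X.integrable_S t).sub (X.integrable_S s)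
  have h1 : μ[fun ω => X.S t ω - X.S s ω | X.filtration s] =ᵐ[μ]
      fun _ => ∫ ω, (X.S t ω - X.S s ω) ∂μ := by
    refine condExp_indep_eq (((X.measurable_S t).sub (X.measurable_S s)).comap_le)
      (X.filtration.le s) ?_ (X.indep_filtration hst).symm
    exact (comap_measurable _).stronglyMeasurable
  have h2 : X.M t = (X.M s + fun _ => (X.meanClaims t - X.meanClaims s)) -
      fun ω => X.S t ω - X.S s ω := by
    ext ω
    simp only [M, meanClaims, Pi.add_apply, Pi.sub_apply]
    ring
  rw [h2]
  refine (condExp_sub ((hint s).add (integrable_const _)) hinc _).trans ?_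
  have h3 : μ[X.M s + fun _ => (X.meanClaims t - X.meanClaims s) | X.filtration s] =
      X.M s + fun _ => (X.meanClaims t - X.meanClaims s) :=
    condExp_of_stronglyMeasurable (X.filtration.le s)
      ((X.adapted_M s).add stronglyMeasurable_const) ((hint s).add (integrable_const _))
  rw [h3]
  filter_upwards [h1] with ω hω
  rw [Pi.sub_apply, hω, integral_sub (X.integrable_S t) (X.integrable_S s)]
  simp [meanClaims]

lemma isIncreasing_meanClaims (T : ℝ≥0) : IsIncreasing μ X.filtration T (fun t _ => X.meanClaims t) where
  adapted _ := stronglyMeasurable_const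
  integrable _ _ := integrable_const _
  cadlag := .of_forall fun _ => isCadlag_of_continuous X.continuous_meanClaims
  mono := .of_forall fun _ => X.meanClaims_mono

lemma martingale_S_sub : Martingale (fun t ω => X.S t ω - X.meanClaims t) X.filtration μ := by
  have h : (fun t ω => X.S t ω - X.meanClaims t) = -X.M := by
    ext t ω; simp [M, meanClaims]
  rw [h]
  exact X.martingale_M.neg

/-- The value function `E[Φ(M_T) | S_t = s]`. -/
noncomputable def value (T : ℝ≥0) (Φ : ℝ → ℝ) (t : ℝ≥0) (s : ℝ) : ℝ :=
  ∫ ω, Φ (X.meanClaims T - (s + (X.S T ω - X.S t ω))) ∂μ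

/-! ### Monotonicity, Lipschitz bounds and continuity of the value function -/

section Value

variable {X} {T : ℝ≥0} {Φ : ℝ → ℝ}

lemma integrable_comp_lipschitz (hl : LipschitzWith 1 Φ) {Z : Ω → ℝ} (hZ : Integrable Z μ) :
    Integrable (fun ω => Φ (Z ω)) μ := by
  refine Integrable.mono' ((integrable_const |Φ 0|).add hZ.norm)
    (hl.continuous.comp_aestronglyMeasurable hZ.1) (.of_forall fun ω => ?_)
  exact abs_le_of_lipschitz hl (Z ω)

lemma integrable_value (hl : LipschitzWith 1 Φ) (t : ℝ≥0) (s : ℝ) :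
    Integrable (fun ω => Φ (X.meanClaims T - (s + (X.S T ω - X.S t ω)))) μ :=
  integrable_comp_lipschitz hl ((integrable_const _).sub
    ((integrable_const s).add ((X.integrable_S T).sub (X.integrable_S t))))

lemma sub_le_of_monotone_lipschitz (hl : LipschitzWith 1 Φ) {x y : ℝ} (hxy : x ≤ y) :
    Φ y - Φ x ≤ y - x := by
  have := hl.dist_le_mul y x
  rw [Real.dist_eq, Real.dist_eq, NNReal.coe_one, one_mul, abs_of_nonneg (sub_nonneg.2 hxy)] at this
  exact (le_abs_self _).trans this

lemma value_anti (hm : Monotone Φ) (hl : LipschitzWith 1 Φ) (t : ℝ≥0) :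
    Antitone (X.value T Φ t) := fun x y hxy =>
  integral_mono (integrable_value hl t y) (integrable_value hl t x)
    fun ω => hm (by linarith)

lemma value_sub_le (hl : LipschitzWith 1 Φ) (t : ℝ≥0) {x y : ℝ} (hxy : x ≤ y) :
    X.value T Φ t x - X.value T Φ t y ≤ y - x := by
  rw [value, value, ← integral_sub (integrable_value hl t x) (integrable_value hl t y)]
  refine (integral_mono ((integrable_value hl t x).sub (integrable_value hl t y))
    (integrable_const (y - x)) fun ω => ?_).trans (by simp)
  refine (sub_le_of_monotone_lipschitz hl (by linarith)).trans (le_of_eq ?_)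
  ring

/-- The remaining claims `S T - S t` decrease in `t` along each path. This monotonicity makes the
compensator of the optimal strategy non-decreasing. -/
lemma value_mono_time (hm : Monotone Φ) (hl : LipschitzWith 1 Φ) (s : ℝ) :
    Monotone fun t => X.value T Φ t s := fun t u htu => by
  refine integral_mono_ae (integrable_value hl t s) (integrable_value hl u s) ?_
  filter_upwards [X.pureJump.mono] with ω hω
  have h : X.S t ω ≤ X.S u ω := hω htu
  exact hm (by linarith)

lemma value_time_sub_le (hl : LipschitzWith 1 Φ) (s : ℝ) {t u : ℝ≥0} (htu : t ≤ u) :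
    X.value T Φ u s - X.value T Φ t s ≤ X.meanClaims u - X.meanClaims t := by
  have e : X.meanClaims u - X.meanClaims t = ∫ ω, (X.S u ω - X.S t ω) ∂μ :=
    (integral_sub (X.integrable_S u) (X.integrable_S t)).symm
  rw [e, value, value, ← integral_sub (integrable_value hl u s) (integrable_value hl t s)]
  refine integral_mono_ae ((integrable_value hl u s).sub (integrable_value hl t s))
    ((X.integrable_S u).sub (X.integrable_S t)) ?_
  filter_upwards [X.pureJump.mono] with ω hω
  have h : X.S t ω ≤ X.S u ω := hω htu
  refine (sub_le_of_monotone_lipschitz hl (by linarith)).trans (le_of_eq ?_)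
  ring

lemma abs_value_sub_le (hm : Monotone Φ) (hl : LipschitzWith 1 Φ) (t u : ℝ≥0) (x y : ℝ) :
    |X.value T Φ t x - X.value T Φ u y| ≤ |X.meanClaims t - X.meanClaims u| + |x - y| := by
  have h1 : |X.value T Φ t x - X.value T Φ u x| ≤ |X.meanClaims t - X.meanClaims u| := by
    wlog h : u ≤ t generalizing t u
    · rw [abs_sub_comm, abs_sub_comm (X.meanClaims t)]
      exact this u t (le_of_not_ge h)
    · rw [abs_of_nonneg (sub_nonneg.2 (value_mono_time hm hl x h))]
      exact (value_time_sub_le hl x h).trans (le_abs_self _)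
  have h2 : |X.value T Φ u x - X.value T Φ u y| ≤ |x - y| := by
    wlog h : x ≤ y generalizing x y
    · rw [abs_sub_comm, abs_sub_comm x]
      -- Exchanging `x` and `y` calls for the time estimate `h1` at `y`, which is proved again.
      refine this y x ?_ (le_of_not_ge h)
      clear this
      wlog h : u ≤ t generalizing t u
      · rw [abs_sub_comm, abs_sub_comm (X.meanClaims t)]
        exact this u t (by rwa [abs_sub_comm, abs_sub_comm (X.meanClaims u)]) (le_of_not_ge h)
      · rw [abs_of_nonneg (sub_nonneg.2 (value_mono_time hm hl y h))]
        exact (value_time_sub_le hl y h).trans (le_abs_self _)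
    · rw [abs_of_nonneg (sub_nonneg.2 (value_anti hm hl u h)), abs_sub_comm]
      exact (value_sub_le hl u h).trans (le_abs_self _)
  calc _ = |(X.value T Φ t x - X.value T Φ u x) + (X.value T Φ u x - X.value T Φ u y)| := by ring_nf
    _ ≤ _ := (abs_add_le _ _).trans (add_le_add h1 h2)

lemma continuous_value (hm : Monotone Φ) (hl : LipschitzWith 1 Φ) :
    Continuous (Function.uncurry (X.value T Φ)) := by
  refine continuous_iff_continuousAt.2 fun x => ?_
  refine tendsto_iff_dist_tendsto_zero.2 ?_
  have hc : Continuous fun y : ℝ≥0 × ℝ =>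
      |X.meanClaims y.1 - X.meanClaims x.1| + |y.2 - x.2| := by
    have := X.continuous_meanClaims
    fun_prop
  have h0 := hc.tendsto x
  simp only [sub_self, abs_zero, add_zero] at h0
  exact squeeze_zero (fun _ => dist_nonneg) (fun y => abs_value_sub_le hm hl y.1 x.1 y.2 x.2) h0

lemma isAntitoneLip_value (hm : Monotone Φ) (hl : LipschitzWith 1 Φ) :
    IsAntitoneLip (X.value T Φ) :=
  ⟨continuous_value hm hl, value_anti hm hl, fun t _ _ h => value_sub_le hl t h⟩

lemma value_S_ae_eq_condExp (hm : Monotone Φ) (hl : LipschitzWith 1 Φ) {t : ℝ≥0} (ht : t ≤ T) :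
    (fun ω => X.value T Φ t (X.S t ω)) =ᵐ[μ] μ[fun ω => Φ (X.M T ω) | X.filtration t] := by
  have hG : Continuous fun y => Φ (X.meanClaims T - y) :=
    hl.continuous.comp (continuous_const.sub continuous_id)
  have heq : (fun ω => Φ (X.M T ω)) =
      fun ω => Φ (X.meanClaims T - (X.S t ω + (X.S T ω - X.S t ω))) := by
    ext ω; simp [M, meanClaims]
  have h := condExp_comp_add_of_indep (X.filtration.le t) (X.adapted_S t).measurable
    ((X.measurable_S T).sub (X.measurable_S t)) (X.indep_filtration ht) hG
    (by
      change Integrable (fun ω => Φ (X.meanClaims T - (X.S t ω + (X.S T ω - X.S t ω)))) μ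
      rw [← heq]
      exact integrable_comp_lipschitz hl (X.martingale_M.integrable T))
    ((continuous_value (X := X) (T := T) hm hl).comp (continuous_const (y := t) |>.prodMk continuous_id))
  rw [heq]
  exact h

lemma value_zero :
    X.value T Φ 0 0 = ∫ ω, Φ (X.M T ω) ∂μ := by
  refine integral_congr_ae ?_
  filter_upwards [X.ae_zero] with ω hω
  simp [hω, M, meanClaims]

end Value

end SurplusModel

/-! ### Predictability of grid sums -/

section Predictable

variable {Ω : Type*} [m : MeasurableSpace Ω] {ℱ : Filtration ℝ≥0 m}

lemma measurable_fst_predictable : Measurable[ℱ.predictable] (Prod.fst : ℝ≥0 × Ω → ℝ≥0) := by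
  let : MeasurableSpace (ℝ≥0 × Ω) := ℱ.predictable
  refine measurable_of_Ioi fun a => ?_
  rw [show (Prod.fst : ℝ≥0 × Ω → ℝ≥0) ⁻¹' Set.Ioi a = Set.Ioi a ×ˢ Set.univ by ext; simp]
  exact measurableSet_predictable_Ioi_prod MeasurableSet.univ

lemma measurable_indicator_Ioi_predictable {i : ℝ≥0} {Z : Ω → ℝ} (hZ : Measurable[ℱ i] Z) :
    Measurable[ℱ.predictable] ((Set.Ioi i ×ˢ Set.univ).indicator fun x : ℝ≥0 × Ω => Z x.2) := by
  intro U hU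
  have hI : MeasurableSet[ℱ.predictable] (Set.Ioi i ×ˢ (Set.univ : Set Ω)) :=
    measurableSet_predictable_Ioi_prod MeasurableSet.univ
  have h : ((Set.Ioi i ×ˢ Set.univ).indicator fun x : ℝ≥0 × Ω => Z x.2) ⁻¹' U =
      (Set.Ioi i ×ˢ (Z ⁻¹' U)) ∪ ((Set.Ioi i ×ˢ Set.univ)ᶜ ∩ {_x | (0 : ℝ) ∈ U}) := by
    ext x
    by_cases hx : i < x.1 <;> simp [Set.indicator, hx]
  rw [h]
  exact (measurableSet_predictable_Ioi_prod (hZ hU)).union (hI.compl.inter (MeasurableSet.const _))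

/-- Each summand vanishes up to `grid n k` and afterwards depends on `S` only through its value at
`min T (grid n k)`, already known at time `grid n k`. -/
lemma measurable_timeSum_predictable {φ : ℝ≥0 → ℝ → ℝ} (hφ : Continuous (Function.uncurry φ))
    {S : ℝ≥0 → Ω → ℝ} (hS : StronglyAdapted ℱ S) (T : ℝ≥0) (K n : ℕ) :
    Measurable[ℱ.predictable]
      (fun x : ℝ≥0 × Ω => timeSum φ (fun s => S s x.2) K n (min x.1 T)) := by
  let : MeasurableSpace (ℝ≥0 × Ω) := ℱ.predictable
  refine Finset.measurable_fun_sum _ fun k _ => ?_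
  set W : ℝ≥0 × Ω → ℝ :=
    (Set.Ioi (grid n k) ×ˢ Set.univ).indicator fun x => S (min T (grid n k)) x.2
  have hW : Measurable W := measurable_indicator_Ioi_predictable
    (((hS (min T (grid n k))).mono (ℱ.mono (min_le_right _ _))).measurable)
  have hfst : Measurable (Prod.fst : ℝ≥0 × Ω → ℝ≥0) := measurable_fst_predictable
  have heq : (fun x : ℝ≥0 × Ω =>
      φ (min (min x.1 T) (grid n (k + 1))) (S (min (min x.1 T) (grid n k)) x.2) -
        φ (min (min x.1 T) (grid n k)) (S (min (min x.1 T) (grid n k)) x.2)) =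
      (Set.Ioi (grid n k) ×ˢ Set.univ).indicator (fun x =>
        φ (min (min x.1 T) (grid n (k + 1))) (W x) - φ (min T (grid n k)) (W x)) := by
    ext x
    by_cases hx : grid n k < x.1
    · have hmem : x ∈ Set.Ioi (grid n k) ×ˢ (Set.univ : Set Ω) := ⟨hx, trivial⟩
      rw [Set.indicator_of_mem hmem]
      simp only [W]
      rw [Set.indicator_of_mem hmem, min_assoc, min_assoc, min_eq_right (a := x.1)
        (b := min T (grid n k)) ((min_le_right _ _).trans hx.le)]
    · rw [Set.indicator_of_notMem (fun h => hx h.1)]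
      have h1 : min x.1 T ≤ grid n k := (min_le_left _ _).trans (not_lt.1 hx)
      rw [min_eq_left h1, min_eq_left (h1.trans (grid_mono n k.le_succ)), sub_self]
  rw [heq]
  refine Measurable.indicator ?_ (measurableSet_predictable_Ioi_prod MeasurableSet.univ)
  have h1 : Measurable fun x : ℝ≥0 × Ω => Function.uncurry φ
      (min (min x.1 T) (grid n (k + 1)), W x) :=
    hφ.measurable.comp (((hfst.min measurable_const).min measurable_const).prodMk hW)
  have h2 : Measurable fun x : ℝ≥0 × Ω => Function.uncurry φ (min T (grid n k), W x) :=
    hφ.measurable.comp (measurable_const.prodMk hW)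
  exact h1.sub h2

end Predictable

/-! ### Stopped grid limits along a pure-jump path -/

section Limits

variable {φ : ℝ≥0 → ℝ → ℝ} {s : ℝ≥0 → ℝ} {T : ℝ≥0}

lemma jumpSum_min (c : ℝ≥0 → ℝ) (t T : ℝ≥0) :
    jumpSum c (min t T) = jumpSum ((Set.Iic T).indicator c) t := by
  unfold jumpSum
  rw [Set.indicator_indicator, Set.Iic_inter_Iic]

/-- The limit of the stopped sums of space decrements. -/
noncomputable def spaceLimit (φ : ℝ≥0 → ℝ → ℝ) (s : ℝ≥0 → ℝ) (T t : ℝ≥0) : ℝ :=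
  limUnder atTop fun n => spaceSum φ s (gridCard T n) n (min t T)

/-- The limit of the stopped sums of time increments. -/
noncomputable def timeLimit (φ : ℝ≥0 → ℝ → ℝ) (s : ℝ≥0 → ℝ) (T t : ℝ≥0) : ℝ :=
  limUnder atTop fun n => timeSum φ s (gridCard T n) n (min t T)

lemma spaceLimit_eq (hφ : IsAntitoneLip φ) (hs : IsPureJumpPath s) (t : ℝ≥0) :
    spaceLimit φ s T t = jumpSum ((Set.Iic T).indicator (jumpDecr φ s)) t := by
  rw [← jumpSum_min]
  exact (tendsto_spaceSum hφ hs (min_le_right t T)).limUnder_eq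

/-- Convergence comes from that of the space sums and the telescoping identity, so no
differentiability of `φ` in time is required. -/
lemma tendsto_timeSum (hφ : IsAntitoneLip φ) (hs : IsPureJumpPath s) (t : ℝ≥0) :
    Tendsto (fun n => timeSum φ s (gridCard T n) n (min t T)) atTop
      (𝓝 (spaceLimit φ s T t + (φ (min t T) (s (min t T)) - φ 0 (s 0)))) := by
  rw [spaceLimit_eq hφ hs, ← jumpSum_min]
  refine ((tendsto_spaceSum hφ hs (min_le_right t T)).add_const _).congr fun n => ?_
  rw [← timeSum_sub_spaceSum φ s n (min_le_right t T)]
  ring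

lemma timeLimit_eq (hφ : IsAntitoneLip φ) (hs : IsPureJumpPath s) (t : ℝ≥0) :
    timeLimit φ s T t = spaceLimit φ s T t + (φ (min t T) (s (min t T)) - φ 0 (s 0)) :=
  (tendsto_timeSum hφ hs t).limUnder_eq

lemma spaceLimit_path (hφ : IsAntitoneLip φ) (hs : IsPureJumpPath s) (T : ℝ≥0) :
    IsPureJumpPath (spaceLimit φ s T) ∧
      pathJump (spaceLimit φ s T) = (Set.Iic T).indicator (jumpDecr φ s) := by
  have h : spaceLimit φ s T = jumpSum ((Set.Iic T).indicator (jumpDecr φ s)) :=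
    funext fun t => spaceLimit_eq hφ hs t
  rw [h]
  refine isPureJumpPath_jumpSum hs
    (fun r => Set.indicator_nonneg (fun r _ => jumpDecr_nonneg hφ hs.mono r) r) fun r => ?_
  exact Set.indicator_le' (fun r _ => jumpDecr_le hφ hs.mono r)
    (fun r _ => pathJump_nonneg hs.mono r) r

lemma timeLimit_zero (hφ : IsAntitoneLip φ) (hs : IsPureJumpPath s) : timeLimit φ s T 0 = 0 := by
  rw [timeLimit_eq hφ hs, (spaceLimit_path hφ hs T).1.zero, min_eq_left zero_le, sub_self, add_zero]

lemma timeLimit_mono (hφ : IsAntitoneLip φ) (hφt : ∀ x, Monotone fun t => φ t x)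
    (hs : IsPureJumpPath s) : Monotone (timeLimit φ s T) := by
  intro t u htu
  rw [timeLimit_eq hφ hs, timeLimit_eq hφ hs]
  exact le_of_tendsto_of_tendsto' (tendsto_timeSum hφ hs t) (tendsto_timeSum hφ hs u)
    fun n => timeSum_mono hφt s _ n (min_le_min_right T htu)

lemma timeLimit_cadlag (hφ : IsAntitoneLip φ) (hφt : ∀ x, Monotone fun t => φ t x)
    (hs : IsPureJumpPath s) : IsCadlag (timeLimit φ s T) := by
  refine isCadlag_of_monotone (timeLimit_mono hφ hφt hs) fun t => ?_
  have h : timeLimit φ s T =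
      fun t => spaceLimit φ s T t + (φ (min t T) (s (min t T)) - φ 0 (s 0)) :=
    funext fun t => timeLimit_eq hφ hs t
  rw [h]
  refine ((spaceLimit_path hφ hs T).1.cadlag t).1.add (ContinuousWithinAt.sub ?_
    continuousWithinAt_const)
  have h1 : ContinuousWithinAt (fun t => min t T) (Set.Ici t) t :=
    (continuous_id.min continuous_const).continuousWithinAt
  have h2 : ContinuousWithinAt (fun t => s (min t T)) (Set.Ici t) t :=
    ContinuousWithinAt.comp (t := Set.Ici (min t T)) (hs.cadlag (min t T)).1 h1
      fun u hu => min_le_min_right T hu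
  change ContinuousWithinAt (Function.uncurry φ ∘ fun t => (min t T, s (min t T))) (Set.Ici t) t
  exact ContinuousAt.comp_continuousWithinAt hφ.cont.continuousAt (h1.prodMk h2)

/-- Each grid sum sees `S` at finitely many times up to `min t T`, which is why the retained claims
are defined as a grid limit and not as a sum over jump times. The σ-algebra is arbitrary so that it
can be taken to be `X.filtration t`. -/
lemma stronglyMeasurable_spaceLimit {Ω : Type*} [MeasurableSpace Ω] {φ : ℝ≥0 → ℝ → ℝ}
    (hφ : Continuous (Function.uncurry φ)) {S : ℝ≥0 → Ω → ℝ} {T t : ℝ≥0}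
    (hS : ∀ v ≤ min t T, Measurable (S v)) :
    StronglyMeasurable fun ω => spaceLimit φ (fun s => S s ω) T t := by
  refine StronglyMeasurable.limUnder fun n => Measurable.stronglyMeasurable ?_
  refine Finset.measurable_fun_sum _ fun k _ => ?_
  have h : ∀ v w : ℝ≥0, Measurable fun ω => φ v (S (min (min t T) w) ω) := fun v w =>
    hφ.measurable.comp (measurable_const.prodMk (hS _ (min_le_left _ _)))
  exact (h _ _).sub (h _ _)

end Limits

/-! ### The optimal strategy -/

namespace SurplusModel

variable {Ω : Type*} [m : MeasurableSpace Ω] {μ : Measure Ω} (X : SurplusModel μ)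

/-- The strategy with initial capital `u` whose martingale part is the value process. -/
noncomputable def valueStrategy (T : ℝ≥0) (Φ : ℝ → ℝ) (u : ℝ) : Strategy Ω where
  u₀ := u
  S t ω := spaceLimit (X.value T Φ) (fun s => X.S s ω) T t
  A t ω := timeLimit (X.value T Φ) (fun s => X.S s ω) T t

variable [IsProbabilityMeasure μ] {X} {T : ℝ≥0} {Φ : ℝ → ℝ} {u : ℝ}

lemma adapted_valueStrategy_S (hm : Monotone Φ) (hl : LipschitzWith 1 Φ) :
    StronglyAdapted X.filtration (X.valueStrategy T Φ u).S := by
  intro t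
  exact @stronglyMeasurable_spaceLimit Ω (X.filtration t) _ (continuous_value hm hl) _ _ _
    fun v hv => ((X.adapted_S v).mono (X.filtration.mono (hv.trans (min_le_left _ _)))).measurable

lemma predictable_valueStrategy_A (hm : Monotone Φ) (hl : LipschitzWith 1 Φ) :
    IsStronglyPredictable X.filtration (X.valueStrategy T Φ u).A := by
  have hcont := continuous_value (X := X) (T := T) hm hl
  let : MeasurableSpace (ℝ≥0 × Ω) := X.filtration.predictable
  exact StronglyMeasurable.limUnder fun n => Measurable.stronglyMeasurable
    (measurable_timeSum_predictable hcont X.adapted_S T _ n)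

/-- The time and space limits differ by `v(t,S_t) - v(0,0)`, stopped at `T`, and the centring `h0`
removes the constant. -/
lemma ae_valueStrategy_M (hm : Monotone Φ) (hl : LipschitzWith 1 Φ)
    (h0 : ∫ ω, Φ (X.M T ω) ∂μ = 0) :
    ∀ᵐ ω ∂μ, ∀ t, (X.valueStrategy T Φ u).M t ω = X.value T Φ (min t T) (X.S (min t T) ω) := by
  filter_upwards [X.ae_path] with ω hω t
  have h1 := timeLimit_eq (T := T) (isAntitoneLip_value (X := X) (T := T) hm hl) hω t
  simp only [Strategy.M, valueStrategy]
  rw [h1, hω.zero, value_zero, h0]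
  ring

lemma valueStrategy_M_ae_eq_condExp (hm : Monotone Φ) (hl : LipschitzWith 1 Φ)
    (h0 : ∫ ω, Φ (X.M T ω) ∂μ = 0) (t : ℝ≥0) :
    (X.valueStrategy T Φ u).M t =ᵐ[μ] μ[fun ω => Φ (X.M T ω) | X.filtration (min t T)] := by
  filter_upwards [ae_valueStrategy_M (u := u) hm hl h0,
    value_S_ae_eq_condExp (X := X) hm hl (min_le_right t T)] with ω h1 h2
  rw [h1, ← h2]

lemma martingale_valueStrategy (hm : Monotone Φ) (hl : LipschitzWith 1 Φ)
    (h0 : ∫ ω, Φ (X.M T ω) ∂μ = 0) :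
    Martingale (X.valueStrategy T Φ u).M X.filtration μ := by
  refine ⟨fun t => ((predictable_valueStrategy_A hm hl).stronglyAdapted t).sub
    (adapted_valueStrategy_S (u := u) hm hl t), fun s t hst => ?_⟩
  refine (condExp_congr_ae (valueStrategy_M_ae_eq_condExp hm hl h0 t)).trans ?_
  refine EventuallyEq.trans ?_ (valueStrategy_M_ae_eq_condExp hm hl h0 s).symm
  rcases le_total s T with hs | hs
  · rw [min_eq_left hs]
    exact condExp_condExp_of_le (X.filtration.mono (le_min hst hs)) (X.filtration.le _)
  · rw [min_eq_right hs, min_eq_right (hs.trans hst), condExp_of_stronglyMeasurable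
      (X.filtration.le s) (stronglyMeasurable_condExp.mono (X.filtration.mono hs)) integrable_condExp]

lemma isAdmissible_valueStrategy (hu : 0 ≤ u) (hm : Monotone Φ) (hl : LipschitzWith 1 Φ)
    (h0 : ∫ ω, Φ (X.M T ω) ∂μ = 0) : X.IsAdmissible T (X.valueStrategy T Φ u) := by
  have hφ := isAntitoneLip_value (X := X) (T := T) hm hl
  have hφt := value_mono_time (X := X) (T := T) hm hl
  refine ⟨hu, adapted_valueStrategy_S hm hl, ⟨?_, ?_, ?_, ?_⟩,
    ⟨predictable_valueStrategy_A hm hl, ?_, ?_, ?_, ?_⟩, ?_⟩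
  · filter_upwards [X.ae_path] with ω hω using (spaceLimit_path hφ hω T).1.zero
  · filter_upwards [X.ae_path] with ω hω using (spaceLimit_path hφ hω T).1.cadlag
  · filter_upwards [X.ae_path] with ω hω using (spaceLimit_path hφ hω T).1.mono
  · filter_upwards [X.ae_path] with ω hω using (spaceLimit_path hφ hω T).1.sum_jumps
  · filter_upwards [X.ae_path] with ω hω using timeLimit_zero hφ hω
  · filter_upwards [X.ae_path] with ω hω using timeLimit_cadlag hφ hφt hω
  · filter_upwards [X.ae_path] with ω hω using timeLimit_mono hφ hφt hω
  · have h : (fun t ω => (X.valueStrategy T Φ u).S t ω - (X.valueStrategy T Φ u).A t ω) =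
        -(X.valueStrategy T Φ u).M := by
      ext t ω; simp [Strategy.M]
    rw [h]
    exact (martingale_valueStrategy hm hl h0).neg
  · filter_upwards [X.ae_path] with ω hω t ht
    have h := congrFun (spaceLimit_path hφ hω T).2 t
    rw [Set.indicator_of_mem (show t ∈ Set.Iic T from ht)] at h
    change 0 ≤ pathJump (spaceLimit (X.value T Φ) (fun s => X.S s ω) T) t ∧
      pathJump (spaceLimit (X.value T Φ) (fun s => X.S s ω) T) t ≤ pathJump (fun s => X.S s ω) t
    rw [h]
    exact ⟨jumpDecr_nonneg hφ hω.mono t, jumpDecr_le hφ hω.mono t⟩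

/-- Conditioning on the whole past gives a function of `S t`, hence of `M t`; the tower property
then identifies it with conditioning on `M t` alone. -/
lemma bassM_ae_eq_value {ν : Measure ℝ} {F : ℝ → ℝ} (hm : Monotone F) (hl : LipschitzWith 1 F)
    {t : ℝ≥0} (ht : t ≤ T) : X.bassM T ν F t =ᵐ[μ]
      fun ω => X.value T (fun x => F x - ∫ x, x ∂ν) t (X.S t ω) := by
  have hm' : Monotone fun x => F x - ∫ x, x ∂ν := fun a b hab => sub_le_sub_right (hm hab) _
  have hl' : LipschitzWith 1 fun x => F x - ∫ x, x ∂ν := by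
    simpa [sub_eq_add_neg] using hl.add (LipschitzWith.const (-∫ x, x ∂ν))
  have hle : MeasurableSpace.comap (X.M t) inferInstance ≤ X.filtration t :=
    (X.adapted_M t).measurable.comap_le
  have h1 := value_S_ae_eq_condExp (X := X) (T := T) hm' hl' ht
  have h2 := condExp_condExp_of_le (μ := μ) (f := fun ω => F (X.M T ω) - ∫ x, x ∂ν) hle
    (X.filtration.le t)
  refine h2.symm.trans ((condExp_congr_ae h1.symm).trans ?_)
  rw [condExp_of_stronglyMeasurable (hle.trans (X.filtration.le t)) ?_
    (integrable_condExp.congr h1.symm)]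
  have hc : Continuous (Function.uncurry (X.value T fun x => F x - ∫ x, x ∂ν)) :=
    continuous_value hm' hl'
  have hS : Measurable[MeasurableSpace.comap (X.M t) inferInstance] fun ω => X.S t ω := by
    have h : (fun ω => X.S t ω) = fun ω => X.meanClaims t - X.M t ω := funext fun ω => X.S_eq t ω
    rw [h]
    exact measurable_const.sub (comap_measurable _)
  exact (hc.measurable.comp (measurable_const.prodMk hS)).stronglyMeasurable

end SurplusModel

namespace SurplusModel

/-! ### Admissible strategies -/

variable {Ω : Type*} [m : MeasurableSpace Ω] {μ : Measure Ω} {X : SurplusModel μ} {T : ℝ≥0}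

namespace IsAdmissible

variable {R : Strategy Ω}

lemma ae_S_mem_Icc (hR : X.IsAdmissible T R) : ∀ᵐ ω ∂μ, ∀ t ≤ T, R.S t ω ∈ Set.Icc 0 (X.S t ω) := by
  filter_upwards [hR.pureJump.ae_isPureJumpPath, X.ae_path, hR.jump_le] with ω h1 h2 h3 t ht
  refine ⟨h1.zero ▸ h1.mono zero_le, hasSum_le (fun s => ?_) (h1.sum_jumps t) (h2.sum_jumps t)⟩
  exact (h3 s (s.2.trans ht)).2

lemma integrable_S (hR : X.IsAdmissible T R) {t : ℝ≥0} (ht : t ≤ T) : Integrable (R.S t) μ := by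
  refine Integrable.mono' (X.integrable_S t)
    ((hR.adapted t).mono (X.filtration.le t)).aestronglyMeasurable ?_
  filter_upwards [hR.ae_S_mem_Icc] with ω h
  rw [Real.norm_of_nonneg (h t ht).1]
  exact (h t ht).2

lemma isIncreasing_S (hR : X.IsAdmissible T R) : IsIncreasing μ X.filtration T R.S where
  adapted := hR.adapted
  integrable _ ht := hR.integrable_S ht
  cadlag := hR.pureJump.cadlag
  mono := hR.pureJump.mono

lemma isIncreasing_A (hR : X.IsAdmissible T R) : IsIncreasing μ X.filtration T R.A where
  adapted := hR.compensator.predictable.stronglyAdapted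
  integrable t ht := by
    refine ((hR.integrable_S ht).sub (hR.compensator.martingale.integrable t)).congr
      (.of_forall fun ω => ?_)
    simp
  cadlag := hR.compensator.cadlag
  mono := hR.compensator.mono

lemma martingale_M (hR : X.IsAdmissible T R) : Martingale R.M X.filtration μ := by
  have h : R.M = -fun t ω => R.S t ω - R.A t ω := by
    ext t ω; simp [Strategy.M]
  rw [h]
  exact hR.compensator.martingale.neg

variable [IsProbabilityMeasure μ]

lemma ae_pathJump_A (hR : X.IsAdmissible T R) :
    ∀ᵐ ω ∂μ, ∀ t ≤ T, pathJump (fun s => R.A s ω) t = 0 :=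
  ae_pathJump_compensator_eq_zero hR.isIncreasing_S hR.isIncreasing_A (X.isIncreasing_S T)
    (X.isIncreasing_meanClaims T) hR.compensator.predictable hR.compensator.martingale
    X.martingale_S_sub (.of_forall fun _ => X.continuous_meanClaims)
    (by filter_upwards [hR.jump_le] with ω h t ht using (h t ht).2)

/-- The cost of an admissible strategy is the squared `L²`-distance between the terminal values of
the martingales before and after reinsurance. -/
theorem cost_eq (hR : X.IsAdmissible T R) :
    X.cost T R = ∫⁻ ω, ENNReal.ofReal ((R.M T ω - X.M T ω) ^ 2) ∂μ := by
  refine le_antisymm ?_ ?_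
  · have hc : ∀ᵐ ω ∂μ, IsCadlag fun t => (R.M - X.M) t ω := by
      filter_upwards [hR.compensator.cadlag, hR.pureJump.cadlag, X.pureJump.cadlag] with ω h1 h2 h3
      exact (h1.sub h2).sub ((isCadlag_of_continuous X.continuous_meanClaims).sub h3)
    refine le_trans (le_of_eq (lintegral_congr_ae ?_))
      (lintegral_tsum_sq_jump_le (T := T) (hR.martingale_M.sub X.martingale_M) hc)
    filter_upwards [hR.compensator.cadlag, hR.pureJump.cadlag, X.pureJump.cadlag,
      hR.ae_pathJump_A] with ω h1 h2 h3 h4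
    refine tsum_congr fun t => ?_
    have hC := isCadlag_of_continuous X.continuous_meanClaims
    have h5 : pathJump (fun s => (R.M - X.M) s ω) t = jump X.S t ω - jump R.S t ω := by
      have e := pathJump_sub (h1.sub h2) (hC.sub h3) t
      rw [pathJump_sub h1 h2, pathJump_sub hC h3, h4 t t.2.2,
        pathJump_of_continuous X.continuous_meanClaims] at e
      refine Eq.trans e ?_
      change 0 - jump R.S t ω - (0 - jump X.S t ω) = _
      ring
    rw [h5, ← neg_sq, neg_sub]
  -- The difference `M^R - M` is written as a difference of increasing processes, `S + A^R` and `S^R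
  -- + E[S]`, as the energy inequality requires.
  · have hM : Martingale (fun t ω => (X.S t ω + R.A t ω) - (R.S t ω + X.meanClaims t))
        X.filtration μ := by
      have h : (fun t ω => (X.S t ω + R.A t ω) - (R.S t ω + X.meanClaims t)) = R.M - X.M := by
        ext t ω
        simp only [Strategy.M, M, meanClaims, Pi.sub_apply]
        ring
      rw [h]
      exact hR.martingale_M.sub X.martingale_M
    have key := lintegral_sq_sub_le ((X.isIncreasing_S T).add hR.isIncreasing_A)
      (hR.isIncreasing_S.add (X.isIncreasing_meanClaims T))
      (by filter_upwards [X.ae_zero, hR.compensator.zero] with ω h1 h2; rw [h1, h2, add_zero])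
      (by filter_upwards [hR.pureJump.zero] with ω h1; rw [h1, X.meanClaims_zero, add_zero]) hM
    have e : ∀ ω, (X.S T ω + R.A T ω) - (R.S T ω + X.meanClaims T) = R.M T ω - X.M T ω := fun ω => by
      simp only [Strategy.M, M, meanClaims]
      ring
    simp_rw [e] at key
    refine key.trans (le_of_eq (lintegral_congr_ae ?_))
    filter_upwards [hR.compensator.cadlag, hR.pureJump.cadlag, X.pureJump.cadlag,
      hR.ae_pathJump_A] with ω h1 h2 h3 h4
    refine tsum_congr fun t => ?_
    rw [pathJump_add h3 h1, pathJump_add h2 (isCadlag_of_continuous X.continuous_meanClaims),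
      h4 t t.2.2, pathJump_of_continuous X.continuous_meanClaims, add_zero, add_zero, ← neg_sq,
      neg_sub]
    rfl

lemma integral_M_eq_zero (hR : X.IsAdmissible T R) : ∫ ω, R.M T ω ∂μ = 0 := by
  have h := hR.martingale_M.setIntegral_eq (zero_le (a := T)) MeasurableSet.univ
  rw [setIntegral_univ, setIntegral_univ] at h
  rw [← h]
  refine integral_eq_zero_of_ae ?_
  filter_upwards [hR.pureJump.zero, hR.compensator.zero] with ω h1 h2
  simp [Strategy.M, h1, h2]

end IsAdmissible

/-! ### Optimality and uniqueness among feasible strategies -/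

variable [IsProbabilityMeasure μ] {h : Measure (Set.Icc 0 T → ℝ × ℝ) → ℝ≥0 → ℝ}
  {ν : Measure ℝ} {F : ℝ → ℝ} {R : Strategy Ω}

/-- Modifications share finite-dimensional laws, hence the law on the product space. Thus `h`
returns the same surcharge for a strategy and for `bassM`, which agree only almost surely at each
time. -/
lemma jointLaw_congr {N N' : ℝ≥0 → Ω → ℝ} (hN : ∀ t, Measurable (N t))
    (hN' : ∀ t, Measurable (N' t)) (hNN' : ∀ t ≤ T, N t =ᵐ[μ] N' t) :
    X.jointLaw T N = X.jointLaw T N' := by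
  refine map_eq_of_forall_ae_eq (X := fun (t : Set.Icc 0 T) ω => (X.M t ω, N t ω))
    (Y := fun (t : Set.Icc 0 T) ω => (X.M t ω, N' t ω))
    (measurable_pi_lambda _ fun t : Set.Icc 0 T =>
      (X.measurable_M t).prodMk (hN t)).aemeasurable
    (measurable_pi_lambda _ fun t : Set.Icc 0 T =>
      (X.measurable_M t).prodMk (hN' t)).aemeasurable fun t => ?_
  filter_upwards [hNN' t t.2.2] with ω hω
  rw [hω]

lemma measurable_bassM (t : ℝ≥0) : Measurable (X.bassM T ν F t) :=
  (stronglyMeasurable_condExp.mono (X.measurable_M t).comap_le).measurable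

lemma IsAdmissible.measurable_M (hR : X.IsAdmissible T R) (t : ℝ≥0) : Measurable (R.M t) :=
  ((hR.martingale_M.stronglyAdapted t).mono (X.filtration.le t)).measurable

lemma IsAdmissible.drift_eq (hR : X.IsAdmissible T R)
    (hM : ∀ t ≤ T, R.M t =ᵐ[μ] X.bassM T ν F t) (t : ℝ≥0) :
    X.drift T h R.M t = X.drift T h (X.bassM T ν F) t := by
  rw [drift, drift, jointLaw_congr hR.measurable_M measurable_bassM hM]

lemma IsAdmissible.isBass (hR : X.IsAdmissible T R) (hu : R.u₀ = X.bassCapital T h ν F)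
    (hM : ∀ t ≤ T, R.M t =ᵐ[μ] X.bassM T ν F t) : X.IsBass T h ν F R := by
  refine ⟨hu, hM, fun t ht => ?_⟩
  filter_upwards [hM t ht] with ω hω
  rw [reinsured, hR.drift_eq hM, hu, hω]

lemma monotone_sub_const (hm : Monotone F) (c : ℝ) : Monotone fun x => F x - c :=
  fun _ _ hab => sub_le_sub_right (hm hab) _

lemma lipschitz_sub_const (hl : LipschitzWith 1 F) (c : ℝ) : LipschitzWith 1 fun x => F x - c := by
  simpa [sub_eq_add_neg] using hl.add (LipschitzWith.const (-c))

lemma bassM_ae_eq_condExp (hm : Monotone F) (hl : LipschitzWith 1 F) {t : ℝ≥0} (ht : t ≤ T) :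
    X.bassM T ν F t =ᵐ[μ] μ[fun ω => F (X.M T ω) - ∫ x, x ∂ν | X.filtration t] :=
  (bassM_ae_eq_value hm hl ht).trans
    (value_S_ae_eq_condExp (monotone_sub_const hm _) (lipschitz_sub_const hl _) ht)

lemma integrable_terminal (hl : LipschitzWith 1 F) :
    Integrable (fun ω => F (X.M T ω) - ∫ x, x ∂ν) μ :=
  integrable_comp_lipschitz (lipschitz_sub_const hl _) (X.martingale_M.integrable T)

lemma bassM_terminal (hm : Monotone F) (hl : LipschitzWith 1 F) :
    X.bassM T ν F T =ᵐ[μ] fun ω => F (X.M T ω) - ∫ x, x ∂ν := by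
  refine (bassM_ae_eq_condExp hm hl le_rfl).trans (EventuallyEq.of_eq ?_)
  exact condExp_of_stronglyMeasurable (X.filtration.le T)
    ((lipschitz_sub_const hl _).continuous.comp_stronglyMeasurable (X.adapted_M T))
    (integrable_terminal hl)

lemma integral_terminal_eq_zero (hl : LipschitzWith 1 F)
    (hF : HasLaw (fun ω => F (X.M T ω)) ν μ) : ∫ ω, (F (X.M T ω) - ∫ x, x ∂ν) ∂μ = 0 := by
  rw [integral_sub (integrable_comp_lipschitz hl (X.martingale_M.integrable T))
    (integrable_const _), hF.integral_eq]
  simp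

/-- The terminal surplus of a feasible strategy is `mean(ν) + M^R_T`. -/
lemma IsFeasible.const_eq [IsProbabilityMeasure ν] (hR : X.IsFeasible T h ν R) :
    R.u₀ + X.drift T h R.M T = ∫ x, x ∂ν := by
  have h1 := hR.2.integral_eq
  have h2 : ∫ ω, X.reinsured T h R T ω ∂μ = R.u₀ + X.drift T h R.M T := by
    simp only [reinsured]
    rw [integral_add (integrable_const _) (hR.1.martingale_M.integrable T), hR.1.integral_M_eq_zero]
    simp
  rw [← h2, h1]

lemma IsFeasible.identDistrib [IsProbabilityMeasure ν] (hR : X.IsFeasible T h ν R)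
    (hF : HasLaw (fun ω => F (X.M T ω)) ν μ) :
    IdentDistrib (R.M T) (fun ω => F (X.M T ω) - ∫ x, x ∂ν) μ μ := by
  have h1 : IdentDistrib (X.reinsured T h R T) (fun ω => F (X.M T ω)) μ μ :=
    ⟨hR.2.aemeasurable, hF.aemeasurable, hR.2.map_eq.trans hF.map_eq.symm⟩
  have h2 := h1.comp (u := fun x => x - ∫ x, x ∂ν) (by fun_prop)
  convert! h2 using 1
  ext ω
  simp [reinsured, hR.const_eq]

lemma IsFeasible.memLp [IsProbabilityMeasure ν] (hν : MemLp id 2 ν)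
    (hR : X.IsFeasible T h ν R) : MemLp (R.M T) 2 μ := by
  have h1 : MemLp (X.reinsured T h R T) 2 μ := by
    have := hν
    rw [← hR.2.map_eq, memLp_map_measure_iff aestronglyMeasurable_id hR.2.aemeasurable] at this
    exact this
  refine (h1.sub (memLp_const (∫ x, x ∂ν))).ae_eq (.of_forall fun ω => ?_)
  simp [reinsured, hR.const_eq]

/-- The second moment of `M T` is not assumed: it follows from those of `M^R_T`, which has law `ν`
up to a shift, and of `M^R_T - M_T`, which is the cost. -/
lemma IsFeasible.memLp_M [IsProbabilityMeasure ν] (hν : MemLp id 2 ν)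
    (hR : X.IsFeasible T h ν R) (hc : X.cost T R ≠ ∞) :
    MemLp (X.M T) 2 μ := by
  have h1 := hR.memLp hν
  have hm : AEStronglyMeasurable (fun ω => R.M T ω - X.M T ω) μ :=
    h1.1.sub (X.stronglyMeasurable_M T).aestronglyMeasurable
  have h2 : MemLp (fun ω => R.M T ω - X.M T ω) 2 μ := by
    rw [memLp_two_iff_integrable_sq hm]
    refine ⟨hm.pow 2, ?_⟩
    rw [hasFiniteIntegral_iff_ofReal (.of_forall fun ω => sq_nonneg _), ← hR.1.cost_eq]
    exact lt_top_iff_ne_top.2 hc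
  refine (h1.sub h2).ae_eq (.of_forall fun ω => ?_)
  simp

lemma IsAdmissible.cost_eq_ofReal (hR : X.IsAdmissible T R) (h1 : MemLp (R.M T) 2 μ)
    (hM : MemLp (X.M T) 2 μ) :
    X.cost T R = ENNReal.ofReal (∫ ω, (R.M T ω - X.M T ω) ^ 2 ∂μ) := by
  rw [hR.cost_eq, ofReal_integral_eq_lintegral_ofReal
    (f := fun ω => (R.M T ω - X.M T ω) ^ 2) (h1.sub hM).integrable_sq
    (.of_forall fun ω => sq_nonneg _)]

lemma IsAdmissible.isFeasible_of_isBass (hR : X.IsAdmissible T R) (hB : X.IsBass T h ν F R)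
    (hm : Monotone F) (hl : LipschitzWith 1 F) (hF : HasLaw (fun ω => F (X.M T ω)) ν μ) :
    X.IsFeasible T h ν R := by
  refine ⟨hR, hF.congr ?_⟩
  filter_upwards [hB.2.2 T le_rfl, bassM_terminal (X := X) (T := T) (ν := ν) hm hl] with ω h1 h2
  rw [h1, h2, bassCapital]
  ring

lemma IsAdmissible.isOptimal_of_isBass [IsProbabilityMeasure ν] (hν : MemLp id 2 ν)
    (hR : X.IsAdmissible T R) (hB : X.IsBass T h ν F R)
    (hm : Monotone F) (hl : LipschitzWith 1 F) (hF : HasLaw (fun ω => F (X.M T ω)) ν μ) :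
    X.IsOptimal T h ν R := by
  have hfeas := hR.isFeasible_of_isBass hB hm hl hF
  refine ⟨hfeas, fun R' hR' => ?_⟩
  by_cases hc : X.cost T R' = ∞
  · rw [hc]; exact le_top
  have hM := hR'.memLp_M hν hc
  rw [hR.cost_eq_ofReal (hfeas.memLp hν) hM,
    hR'.1.cost_eq_ofReal (hR'.memLp hν) hM]
  refine ENNReal.ofReal_le_ofReal ((le_of_eq ?_).trans
    (integral_sq_map_sub_le (monotone_sub_const hm (∫ x, x ∂ν)) (lipschitz_sub_const hl _) hM
      (hR'.identDistrib hF)))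
  refine integral_congr_ae ?_
  filter_upwards [(hB.2.1 T le_rfl).trans (bassM_terminal hm hl)] with ω hω
  rw [hω]

lemma IsFeasible.isBass_of_cost_le [IsProbabilityMeasure ν] (hν : MemLp id 2 ν)
    (hm : Monotone F) (hl : LipschitzWith 1 F) (hF : HasLaw (fun ω => F (X.M T ω)) ν μ)
    {R₀ : Strategy Ω} (hR₀ : X.IsAdmissible T R₀) (hB : X.IsBass T h ν F R₀)
    (hR : X.IsFeasible T h ν R) (hc : X.cost T R ≠ ∞) (hle : X.cost T R ≤ X.cost T R₀) :
    X.IsBass T h ν F R := by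
  have hM := hR.memLp_M hν hc
  have hm' := monotone_sub_const hm (∫ x, x ∂ν)
  have hl' := lipschitz_sub_const hl (∫ x, x ∂ν)
  have hfeas := hR₀.isFeasible_of_isBass hB hm hl hF
  rw [hR.1.cost_eq_ofReal (hR.memLp hν) hM,
    hR₀.cost_eq_ofReal (hfeas.memLp hν) hM,
    ENNReal.ofReal_le_ofReal_iff (integral_nonneg fun ω => sq_nonneg _)] at hle
  have hT : R.M T =ᵐ[μ] fun ω => F (X.M T ω) - ∫ x, x ∂ν := by
    refine ae_eq_of_integral_sq_sub_le hm' hl' hM (hR.identDistrib hF)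
      (hle.trans (le_of_eq (integral_congr_ae ?_)))
    filter_upwards [(hB.2.1 T le_rfl).trans (bassM_terminal hm hl)] with ω hω
    rw [hω]
  -- Uniqueness of the transport fixes the terminal value; the martingale property carries it back
  -- to earlier times.
  have hMt : ∀ t ≤ T, R.M t =ᵐ[μ] X.bassM T ν F t := fun t ht =>
    (hR.1.martingale_M.condExp_ae_eq ht).symm.trans
      ((condExp_congr_ae hT).trans (bassM_ae_eq_condExp hm hl ht).symm)
  refine hR.1.isBass ?_ hMt
  -- The capital is forced because `u^R_0 + g^R(T) = mean(ν)` and the drifts now coincide.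
  rw [bassCapital, ← hR.1.drift_eq hMt, ← hR.const_eq]
  ring

lemma exists_isBass (hm : Monotone F) (hl : LipschitzWith 1 F)
    (hF : HasLaw (fun ω => F (X.M T ω)) ν μ) (hu : 0 ≤ X.bassCapital T h ν F) :
    ∃ R : Strategy Ω, X.IsAdmissible T R ∧ X.IsBass T h ν F R := by
  have h0 := integral_terminal_eq_zero (X := X) (T := T) hl hF
  have hm' := monotone_sub_const hm (∫ x, x ∂ν)
  have hl' := lipschitz_sub_const hl (∫ x, x ∂ν)
  have hR := isAdmissible_valueStrategy hu hm' hl' h0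
  refine ⟨_, hR, hR.isBass rfl fun t ht => ?_⟩
  have h1 := valueStrategy_M_ae_eq_condExp (u := X.bassCapital T h ν F) hm' hl' h0 t
  rw [min_eq_left ht] at h1
  exact h1.trans (bassM_ae_eq_condExp hm hl ht).symm

end SurplusModel

end Reinsurance

theorem mainTheorem1 {Ω : Type*} [MeasurableSpace Ω] (μ : Measure Ω) [IsProbabilityMeasure μ]
    (X : Reinsurance.SurplusModel μ) (T : ℝ≥0) (hT : 0 < T)
    (h : Measure (Set.Icc 0 T → ℝ × ℝ) → ℝ≥0 → ℝ)
    (ν : Measure ℝ) [IsProbabilityMeasure ν] (hν : MemLp id 2 ν)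
    (F : ℝ → ℝ) (hF_mono : Monotone F) (hF_lip : LipschitzWith 1 F)
    (hF_law : HasLaw (fun ω => F (X.M T ω)) ν μ)
    (h_capital : 0 ≤ X.bassCapital T h ν F) :
    (∃ R : Reinsurance.Strategy Ω, X.IsAdmissible T R ∧ X.IsBass T h ν F R) ∧
    (∀ R : Reinsurance.Strategy Ω, X.IsAdmissible T R → X.IsBass T h ν F R →
      X.IsOptimal T h ν R) ∧
    (∀ R : Reinsurance.Strategy Ω, X.IsOptimal T h ν R → X.cost T R ≠ ∞ →
      X.IsBass T h ν F R) := by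
  obtain ⟨R₀, hR₀, hB₀⟩ :=
    Reinsurance.SurplusModel.exists_isBass hF_mono hF_lip hF_law h_capital
  refine ⟨⟨R₀, hR₀, hB₀⟩, fun R hR hB => hR.isOptimal_of_isBass hν hB hF_mono hF_lip hF_law,
    fun R hR hc => hR.1.isBass_of_cost_le hν hF_mono hF_lip hF_law hR₀ hB₀ hc
      (hR.2 R₀ (hR₀.isFeasible_of_isBass hB₀ hF_mono hF_lip hF_law))⟩
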